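/- Let $\mathbb N=\{1,2,3,\dots\}$. For $\mathbf k=(k_1,\dots,k_r)\in\mathbb N^r$ put $|\mathbf k|=k_1+\cdots+k_r$, and for $n\in\mathbb N$ define $$\zeta^\star_n(\mathbf k)=\sum_{n\ge n_1\ge\cdots\ge n_r\ge 1}\frac{1}{n_1^{k_1}\cdots n_r^{k_r}},\qquad t_n(1_p)=\sum_{n\ge n_1>\cdots>n_p\ge 1}\ \prod_{j=1}^p\frac{1}{2n_j-1}\quad(p\ge 1),\qquad t_n(1_0)=1.$$ For $w\in\mathbb N$ let $\mathrm{CMZV}^2_w$ be the $\mathbb Q$-linear span in $\mathbb C$ of all colored multiple zeta values of level $2$ and weight $w$, that is, of the numbers $$\mathrm{Li}_{\mathbf s}(\mathbf z)=\lim_{n\to\infty}\ \sum_{n\ge n_1>\cdots>n_d\ge 1}\frac{z_1^{n_1}\cdots z_d^{n_d}}{n_1^{s_1}\cdots n_d^{s_d}}$$ with $d\ge 1$, $\mathbf s=(s_1,\dots,s_d)\in\mathbb N^d$, $|\mathbf s|=w$, $\mathbf z\in\{1,-1\}^d$ and $(s_1,z_1)\ne(1,1)$. Then for all integers $p\ge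 0$, $r\ge 1$, $m\ge 1$ and all $\mathbf k\in\mathbb N^r$, the series below converges and $$\sum_{n=1}^\infty\frac{1}{4^n}\binom{2n}{n}\frac{\zeta^\star_n(\mathbf k)\,t_n(1_p)}{n^m}\ \in\ \mathrm{CMZV}^2_{|\mathbf k|+m+p}.$$ -/

import Mathlib

open Filter Topology

noncomputable section

/-- The multiple harmonic star sum
`ζ⋆_n(k₁,…,k_r) = ∑_{n ≥ n₁ ≥ ⋯ ≥ n_r ≥ 1} 1 / (n₁^{k₁} ⋯ n_r^{k_r})`, with value `1` for the
empty composition, written as an iterated sum over `n₁`, then `n₂`, and so on. -/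
def zetaStarSum : List ℕ → ℕ → ℝ
  | [], _ => 1
  | k :: ks, n => ∑ j ∈ Finset.Icc 1 n, 1 / (j : ℝ) ^ k * zetaStarSum ks j

/-- The multiple `t`-harmonic sum
`t_n(k₁,…,k_r) = ∑_{n ≥ n₁ > ⋯ > n_r ≥ 1} 1 / ((2n₁-1)^{k₁} ⋯ (2n_r-1)^{k_r})`, with value `1` for
the empty composition, written as an iterated sum. -/
def tSum : List ℕ → ℕ → ℝ
  | [], _ => 1
  | k :: ks, n => ∑ j ∈ Finset.Icc 1 n, 1 / (2 * (j : ℝ) - 1) ^ k * tSum ks (j - 1)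

/-- The truncated colored multiple zeta sum
`∑_{n ≥ n₁ > ⋯ > n_r ≥ 1} z₁^{n₁} ⋯ z_r^{n_r} / (n₁^{k₁} ⋯ n_r^{k_r})`
for the list `[(k₁, z₁), …, (k_r, z_r)]`, written as an iterated sum. -/
def coloredSum : List (ℕ × ℂ) → ℕ → ℂ
  | [], _ => 1
  | c :: cs, n =>
      ∑ j ∈ Finset.Icc 1 n, c.2 ^ j / (j : ℂ) ^ c.1 * coloredSum cs (j - 1)

/-- `[(k₁, z₁), …, (k_r, z_r)]` is an admissible index of level `N`: `r ≥ 1`, the `k_j` are positive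
integers, the `z_j` are `N`-th roots of unity, and `(k₁, z₁) ≠ (1, 1)`. -/
def IsAdmissibleIndex (N : ℕ) (c : List (ℕ × ℂ)) : Prop :=
  c ≠ [] ∧ (∀ a ∈ c, 1 ≤ a.1 ∧ a.2 ^ N = 1) ∧ c.head? ≠ some (1, 1)

/-- `v` is a colored multiple zeta value `Li_{k₁,…,k_r}(z₁,…,z_r)` of level `N` and weight
`w = k₁ + ⋯ + k_r`; the (possibly only conditionally convergent) series is the limit of its
truncations `n₁ ≤ n`. -/
def IsCMZV (N w : ℕ) (v : ℂ) : Prop :=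
  ∃ c : List (ℕ × ℂ), IsAdmissibleIndex N c ∧ (c.map Prod.fst).sum = w ∧
    Tendsto (coloredSum c) atTop (𝓝 v)

/-- The `ℚ`-linear span in `ℂ` of all colored multiple zeta values of level `N` (`N ≥ 1`) and
weight `w`. -/
def cmzvSpan (N w : ℕ) : Submodule ℚ ℂ :=
  Submodule.span ℚ {v : ℂ | IsCMZV N w v}

end

/-!
Let `α = (1 + x) / 2`. The number `aperyWeight p j = binom(2j, j) / 4 ^ j * t_j(1_p)` is the
coefficient of `x ^ p` in `(α)_j / j! = (-1) ^ j * binom(-α, j)`. With `s j = ζ⋆_j(k) / j ^ m`, the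
series in question is therefore, up to sign, the coefficient of `x ^ p` in the value at `z = -α` of
the Newton series `∑ (-1) ^ (j - 1) * binom(z, j) * s j` (Kawashima's function), which at an integer
`z = M` is a finite star sum (Hoffman duality). The argument avoids `z` and `x`: with `backDiff` the
backward difference operator, the coefficient of `x ^ p` in the value at `M - α` is
`newtonValue (aperyWeight p) s M = -∑ j, aperyWeight p j * (backDiff^[M] s) j`, and the value at `M`
is `-(backDiff^[M] s) 0`.

Two facts determine these values. First, the increments from `N` to `N + 1` are `1 / (N + 1 - α)`
times a value or an increment belonging to a shorter index: `newtonDiff_recursion_id_mul` if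
`m ≥ 2`, `newtonDiff_recursion_sum` if `m = 1`; both express that a series telescopes. As
`N + 1 - α = (2 * N + 1 - x) / 2`, the coefficients of the values at `M - α` are, up to constants of
the form `newtonValue _ _ 0`, nested sums over odd integers `≤ 2 * M`, while those of the values at
`M` are nested sums over even integers. Second, the values at `M - α` and at `M` are asymptotic as
`M → ∞` (`tendsto_newtonValue_add`, by dominated convergence from the complete monotonicity `IsTame`
of `s`). Hence `newtonValue _ _ 0` is the limit of a combination of truncated colored sums of level
`2`, multiplied by constants of the same kind that belong to shorter indices
(`newtonValue_zero_mem`).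

The truncated sums in that combination may diverge individually. Stuffle products write each of them
as a polynomial in the harmonic number `H_N` with an error that is smaller than every power of
`1 / H_N`, the constant coefficient being a combination of colored multiple zeta values of the right
weight (`leadSpan_le_logAsymp`). If a combination converges, its polynomial is constant, so that its
limit is such a value too (`mem_limitSpan_of_tendsto`).
-/

/-! ### Growth of harmonic numbers -/

lemma harmonic_succ_real (n : ℕ) :
    (harmonic (n + 1) : ℝ) = harmonic n + 1 / ((n : ℝ) + 1) := by
  rw [harmonic_succ]; push_cast; ring

lemma harmonic_real_nonneg (n : ℕ) : (0 : ℝ) ≤ harmonic n := by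
  rcases Nat.eq_zero_or_pos n with rfl | h
  · simp
  · exact_mod_cast (harmonic_pos h.ne').le

lemma harmonic_real_mono : Monotone fun n : ℕ => (harmonic n : ℝ) := by
  refine monotone_nat_of_le_succ fun n => ?_
  rw [harmonic_succ_real]
  have : (0 : ℝ) ≤ 1 / ((n : ℝ) + 1) := by positivity
  linarith

lemma exists_harmonic_pow_le (d : ℕ) {ε : ℝ} (hε : 0 < ε) :
    ∃ C : ℝ, 0 < C ∧ ∀ n : ℕ, (harmonic n : ℝ) ^ d ≤ C * ((n : ℝ) + 1) ^ ε := by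
  set δ : ℝ := ε / (d + 1) with hδ
  have hδ0 : 0 < δ := by positivity
  refine ⟨(1 + 1 / δ) ^ d, by positivity, fun n => ?_⟩
  have hx : (1 : ℝ) ≤ (n : ℝ) + 1 := by linarith [Nat.cast_nonneg (α := ℝ) n]
  have h1 : (harmonic n : ℝ) ≤ (1 + 1 / δ) * ((n : ℝ) + 1) ^ δ := by
    have a := harmonic_le_one_add_log (n + 1)
    have b := Real.log_le_rpow_div (x := (n : ℝ) + 1) (by linarith) hδ0
    have c : (1 : ℝ) ≤ ((n : ℝ) + 1) ^ δ := Real.one_le_rpow hx hδ0.le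
    have e : (harmonic n : ℝ) ≤ harmonic (n + 1) := harmonic_real_mono (Nat.le_succ n)
    push_cast at a
    calc (harmonic n : ℝ) ≤ 1 + ((n : ℝ) + 1) ^ δ / δ := by linarith
      _ ≤ (1 + 1 / δ) * ((n : ℝ) + 1) ^ δ := by
        rw [add_mul, one_mul, one_div, div_eq_inv_mul]; linarith
  calc (harmonic n : ℝ) ^ d ≤ ((1 + 1 / δ) * ((n : ℝ) + 1) ^ δ) ^ d :=
        pow_le_pow_left₀ (harmonic_real_nonneg n) h1 d
    _ = (1 + 1 / δ) ^ d * ((n : ℝ) + 1) ^ (δ * d) := by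
        rw [mul_pow, ← Real.rpow_natCast (((n : ℝ) + 1) ^ δ), ← Real.rpow_mul (by linarith)]
    _ ≤ (1 + 1 / δ) ^ d * ((n : ℝ) + 1) ^ ε := by
        refine mul_le_mul_of_nonneg_left (Real.rpow_le_rpow_of_exponent_le hx ?_) (by positivity)
        rw [hδ, div_mul_eq_mul_div, div_le_iff₀ (by positivity)]
        nlinarith

lemma tendsto_rpow_neg_natCast_add_one {ε : ℝ} (hε : 0 < ε) :
    Tendsto (fun n : ℕ => ((n : ℝ) + 1) ^ (-ε)) atTop (𝓝 0) :=
  (tendsto_rpow_neg_atTop hε).comp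
    (tendsto_atTop_add_const_right _ _ tendsto_natCast_atTop_atTop)

/-! ### Iterated backward differences -/

/-- The difference operator `f ↦ (j ↦ f j - f (j + 1))` on sequences. -/
def backDiff (f : ℕ → ℝ) : ℕ → ℝ := fun j => f j - f (j + 1)

lemma backDiff_iterate_succ (f : ℕ → ℝ) (N j : ℕ) :
    backDiff^[N + 1] f j = backDiff^[N] f j - backDiff^[N] f (j + 1) := by
  rw [Function.iterate_succ_apply']; rfl

/-- Leibniz rule for the product of a sequence with the identity sequence. -/
lemma backDiff_iterate_id_mul (f : ℕ → ℝ) (N j : ℕ) :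
    backDiff^[N + 1] (fun i => (i : ℝ) * f i) j =
      j * backDiff^[N + 1] f j - (N + 1) * backDiff^[N] f (j + 1) := by
  induction N generalizing j with
  | zero => simp [backDiff]; ring
  | succ N ih =>
    rw [backDiff_iterate_succ, ih, ih, backDiff_iterate_succ f (N + 1) j]
    have h := backDiff_iterate_succ f N (j + 1)
    push_cast
    linear_combination ((N : ℝ) + 1) * h

lemma backDiff_iterate_of_shift {f g : ℕ → ℝ} (h : ∀ i, g (i + 1) = -backDiff f i) (N j : ℕ) :
    backDiff^[N] g (j + 1) = -backDiff^[N + 1] f j := by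
  induction N generalizing j with
  | zero => simpa using h j
  | succ N ih => rw [backDiff_iterate_succ, ih, ih, backDiff_iterate_succ f (N + 1)]; ring

/-- If `g j = j * f j - (j - 1) * f (j - 1)` for `j ≥ 1`, the iterated differences of `g` are
expressed through those of `f`. -/
lemma backDiff_iterate_of_sum {f g : ℕ → ℝ}
    (h : ∀ i : ℕ, g (i + 1) = ((i + 1 : ℕ) : ℝ) * f (i + 1) - i * f i) (N j : ℕ) :
    backDiff^[N] g (j + 1) = (N + 1) * backDiff^[N] f (j + 1) - j * backDiff^[N + 1] f j := by
  rw [backDiff_iterate_of_shift (f := fun i => (i : ℝ) * f i) (fun i => ?_) N j,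
    backDiff_iterate_id_mul]
  · ring
  · rw [h]; simp only [backDiff]; ring

/-- A completely monotone sequence on the positive integers of moderate decay, whose differences
at a fixed place tend to `0` as their order grows. -/
structure IsTame (f : ℕ → ℝ) : Prop where
  zero : f 0 = 0
  nonneg : ∀ N j, 0 ≤ backDiff^[N] f (j + 1)
  tendsto : ∀ j, Tendsto (fun N => backDiff^[N] f (j + 1)) atTop (𝓝 0)
  decay : ∃ C, ∀ j : ℕ, f (j + 1) ≤ C * ((j : ℝ) + 1) ^ (-(7 / 8 : ℝ))

lemma backDiff_iterate_le {f : ℕ → ℝ} (hf : ∀ N j, 0 ≤ backDiff^[N] f (j + 1)) (N j : ℕ) :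
    backDiff^[N] f (j + 1) ≤ f (j + 1) := by
  induction N with
  | zero => simp
  | succ N ih => rw [backDiff_iterate_succ]; linarith [hf N (j + 1)]

lemma tendsto_backDiff_iterate {f : ℕ → ℝ} (hf : ∀ N j, 0 ≤ backDiff^[N] f (j + 1))
    (h1 : Tendsto (fun N => backDiff^[N] f 1) atTop (𝓝 0)) (j : ℕ) :
    Tendsto (fun N => backDiff^[N] f (j + 1)) atTop (𝓝 0) := by
  refine squeeze_zero (fun N => hf N j) (fun N => ?_) h1
  induction j with
  | zero => exact le_rfl
  | succ j ih =>
    have := hf (N + 1) j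
    rw [backDiff_iterate_succ] at this
    linarith

lemma IsTame.of_id_mul {f g : ℕ → ℝ} (hg : IsTame g) (hfg : ∀ i : ℕ, g i = (i : ℝ) * f i)
    (h0 : f 0 = 0) : IsTame f := by
  have hgf : g = fun i : ℕ => (i : ℝ) * f i := funext hfg
  have key : ∀ N j : ℕ, ((j : ℝ) + 1 + (N + 1)) * backDiff^[N + 1] f (j + 1) =
      backDiff^[N + 1] g (j + 1) + (N + 1) * backDiff^[N] f (j + 1) := by
    intro N j
    have h := backDiff_iterate_id_mul f N (j + 1)
    have h2 := backDiff_iterate_succ f N (j + 1)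
    rw [hgf, h]; push_cast
    linear_combination ((N : ℝ) + 1) * h2
  have hfl : ∀ j : ℕ, f (j + 1) = g (j + 1) / ((j : ℝ) + 1) := by
    intro j; rw [hfg]; push_cast; field_simp
  have hpos : ∀ N j, 0 ≤ backDiff^[N] f (j + 1) := by
    intro N
    induction N with
    | zero =>
      intro j
      have := hg.nonneg 0 j
      simp only [Function.iterate_zero, id] at this ⊢
      rw [hfl]; positivity
    | succ N ih =>
      intro j
      have h1 := key N j
      have h2 : 0 ≤ ((j : ℝ) + 1 + (N + 1)) * backDiff^[N + 1] f (j + 1) := by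
        rw [h1]
        have := hg.nonneg (N + 1) j
        have := ih j
        positivity
      exact nonneg_of_mul_nonneg_right h2 (by positivity)
  refine ⟨h0, hpos, tendsto_backDiff_iterate hpos ?_, ?_⟩
  · -- The differences at `1` are the Cesàro means of those of `g`.
    have hces : ∀ N : ℕ, backDiff^[N] f 1 =
        ((N + 1 : ℕ) : ℝ)⁻¹ * ∑ i ∈ Finset.range (N + 1), backDiff^[i] g 1 := by
      intro N
      induction N with
      | zero => simp [hfg]
      | succ N ih =>
        have h1 := key N 0
        rw [Finset.sum_range_succ, mul_add]
        simp only [zero_add, CharP.cast_eq_zero] at h1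
        rw [ih] at h1
        push_cast at h1 ⊢
        field_simp at h1 ⊢
        linear_combination h1
    have := (hg.tendsto 0).cesaro
    exact (this.comp (tendsto_add_atTop_nat 1)).congr fun N => (hces N).symm
  · obtain ⟨C, hC⟩ := hg.decay
    refine ⟨C, fun j => le_trans ?_ (hC j)⟩
    have := hg.nonneg 0 j
    simp only [Function.iterate_zero, id] at this
    rw [hfl]
    exact div_le_self this (by linarith [Nat.cast_nonneg (α := ℝ) j])

lemma IsTame.of_sum {f g : ℕ → ℝ} (hg : ∀ N j, 0 ≤ backDiff^[N] g (j + 1))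
    (hfg : ∀ i : ℕ, g (i + 1) = ((i + 1 : ℕ) : ℝ) * f (i + 1) - i * f i)
    (h0 : f 0 = 0) (hd : ∃ C, ∀ j : ℕ, f (j + 1) ≤ C * ((j : ℝ) + 1) ^ (-(7 / 8 : ℝ))) :
    IsTame f := by
  have key := backDiff_iterate_of_sum hfg
  have hpos : ∀ N j, 0 ≤ backDiff^[N] f (j + 1) := by
    intro N j
    induction j with
    | zero =>
      have h1 := key N 0
      have h2 := hg N 0
      rw [h1] at h2
      simp only [CharP.cast_eq_zero, zero_mul, sub_zero] at h2
      exact nonneg_of_mul_nonneg_right h2 (by positivity)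
    | succ j ih =>
      have h1 := key N (j + 1)
      rw [backDiff_iterate_succ] at h1
      push_cast at h1
      have h2 : 0 ≤ ((N : ℝ) + 1 + (j + 1)) * backDiff^[N] f (j + 1 + 1) := by
        have := hg N (j + 1)
        have : 0 ≤ ((j : ℝ) + 1) * backDiff^[N] f (j + 1) := by positivity
        linarith
      exact nonneg_of_mul_nonneg_right h2 (by positivity)
  refine ⟨h0, hpos, tendsto_backDiff_iterate hpos ?_, hd⟩
  have h1 : ∀ N, backDiff^[N] f 1 ≤ g 1 * (1 / ((N : ℝ) + 1)) := by
    intro N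
    have h := key N 0
    have h2 := backDiff_iterate_le hg N 0
    simp only [CharP.cast_eq_zero, zero_mul, sub_zero] at h
    rw [mul_one_div, le_div_iff₀ (by positivity)]
    linarith
  refine squeeze_zero (fun N => hpos N 0) h1 ?_
  simpa using (tendsto_one_div_add_atTop_nhds_zero_nat (𝕜 := ℝ)).const_mul (g 1)

/-! ### Series against a weight -/

/-- A nonnegative weight of moderate decay. -/
structure IsWeight (a : ℕ → ℝ) : Prop where
  nonneg : ∀ j, 0 ≤ a j
  decay : ∃ C, ∀ j : ℕ, a j ≤ C * ((j : ℝ) + 1) ^ (-(1 / 4 : ℝ))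

lemma summable_rpow_neg_natCast_add_one {s : ℝ} (hs : 1 < s) :
    Summable fun j : ℕ => ((j : ℝ) + 1) ^ (-s) := by
  have := (summable_nat_add_iff 1).2 (Real.summable_nat_rpow.2 (show -s < -1 by linarith))
  simpa using this

lemma IsWeight.decay_succ {a : ℕ → ℝ} (ha : IsWeight a) :
    ∃ C, 0 ≤ C ∧ ∀ j : ℕ, a j ≤ C * ((j : ℝ) + 1) ^ (-(1 / 4 : ℝ)) ∧
      a (j + 1) ≤ C * ((j : ℝ) + 1) ^ (-(1 / 4 : ℝ)) := by
  obtain ⟨C, hC⟩ := ha.decay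
  have hC0 : 0 ≤ C := by simpa using (ha.nonneg 0).trans (hC 0)
  refine ⟨C, hC0, fun j => ⟨hC j, (hC (j + 1)).trans ?_⟩⟩
  refine mul_le_mul_of_nonneg_left ?_ hC0
  push_cast
  exact Real.rpow_le_rpow_of_nonpos (by positivity) (by linarith) (by norm_num)

lemma exists_weight_mul_le {a f : ℕ → ℝ} (ha : IsWeight a) (hf : IsTame f) :
    ∃ C, ∀ j : ℕ, a j * f (j + 1) ≤ C * ((j : ℝ) + 1) ^ (-(9 / 8 : ℝ)) ∧
      a (j + 1) * f (j + 1) ≤ C * ((j : ℝ) + 1) ^ (-(9 / 8 : ℝ)) := by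
  obtain ⟨C, hC0, hC⟩ := ha.decay_succ
  obtain ⟨D, hD⟩ := hf.decay
  refine ⟨C * D, fun j => ?_⟩
  have hj : (0 : ℝ) < (j : ℝ) + 1 := by positivity
  have e : C * D * ((j : ℝ) + 1) ^ (-(9 / 8 : ℝ)) =
      (C * ((j : ℝ) + 1) ^ (-(1 / 4 : ℝ))) * (D * ((j : ℝ) + 1) ^ (-(7 / 8 : ℝ))) := by
    rw [show (-(9 / 8 : ℝ)) = -(1 / 4) + -(7 / 8) by norm_num, Real.rpow_add hj]; ring
  have h0 := hf.nonneg 0 j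
  simp only [Function.iterate_zero, id] at h0
  rw [e]
  exact ⟨mul_le_mul (hC j).1 (hD j) h0 (by positivity),
    mul_le_mul (hC j).2 (hD j) h0 (by positivity)⟩

lemma summable_weight_mul_succ {a f : ℕ → ℝ} (ha : IsWeight a) (hf : IsTame f) (N : ℕ) :
    Summable fun j => a j * backDiff^[N] f (j + 1) := by
  obtain ⟨C, hC⟩ := exists_weight_mul_le ha hf
  refine Summable.of_nonneg_of_le (fun j => mul_nonneg (ha.nonneg j) (hf.nonneg N j))
    (fun j => (mul_le_mul_of_nonneg_left (backDiff_iterate_le hf.nonneg N j)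
      (ha.nonneg j)).trans (hC j).1)
    ((summable_rpow_neg_natCast_add_one (by norm_num)).mul_left C)

lemma summable_weight_succ_mul_succ {a f : ℕ → ℝ} (ha : IsWeight a) (hf : IsTame f) (N : ℕ) :
    Summable fun j => a (j + 1) * backDiff^[N] f (j + 1) := by
  obtain ⟨C, hC⟩ := exists_weight_mul_le ha hf
  refine Summable.of_nonneg_of_le (fun j => mul_nonneg (ha.nonneg _) (hf.nonneg N j))
    (fun j => (mul_le_mul_of_nonneg_left (backDiff_iterate_le hf.nonneg N j)
      (ha.nonneg _)).trans (hC j).2)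
    ((summable_rpow_neg_natCast_add_one (by norm_num)).mul_left C)

lemma summable_weight_mul {a f : ℕ → ℝ} (ha : IsWeight a) (hf : IsTame f) (N : ℕ) :
    Summable fun j => a j * backDiff^[N] f j :=
  (summable_nat_add_iff 1).1 (summable_weight_succ_mul_succ ha hf N)

/-- The value at `M - α` of the Newton series of which `f` gives the coefficients, where `a` is the
sequence `(α)_j / j!` or one of its Taylor coefficients in a parameter on which `α` depends. -/
noncomputable def newtonValue (a f : ℕ → ℝ) (M : ℕ) : ℝ := -∑' j, a j * backDiff^[M] f j

/-- The increment of `newtonValue a f` from `N` to `N + 1`; see `newtonValue_succ`. -/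
noncomputable def newtonDiff (a f : ℕ → ℝ) (N : ℕ) : ℝ := ∑' j, a j * backDiff^[N] f (j + 1)

lemma newtonValue_succ {a f : ℕ → ℝ} (ha : IsWeight a) (hf : IsTame f) (N : ℕ) :
    newtonValue a f (N + 1) = newtonValue a f N + newtonDiff a f N := by
  have h := (summable_weight_mul ha hf N).tsum_sub (summable_weight_mul_succ ha hf N)
  rw [newtonValue, newtonValue, newtonDiff, neg_add_eq_sub, ← neg_sub, ← h]
  congr 2 with j
  rw [backDiff_iterate_succ]; ring

lemma tsum_sub_succ_eq {c : ℕ → ℝ} (hc : Tendsto c atTop (𝓝 0))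
    (hs : Summable fun j => c j - c (j + 1)) : ∑' j, (c j - c (j + 1)) = c 0 := by
  have h1 := hs.hasSum.tendsto_sum_nat
  simp only [Finset.sum_range_sub'] at h1
  have h2 : Tendsto (fun n => c 0 - c n) atTop (𝓝 (c 0 - 0)) := tendsto_const_nhds.sub hc
  simpa using tendsto_nhds_unique h1 h2

lemma tendsto_id_mul_weight_mul {a f : ℕ → ℝ} (ha : IsWeight a) (hf : IsTame f) (N : ℕ) :
    Tendsto (fun j : ℕ => (j : ℝ) * (a j * backDiff^[N] f j)) atTop (𝓝 0) := by
  rw [← tendsto_add_atTop_iff_nat 1]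
  obtain ⟨C, hC⟩ := exists_weight_mul_le ha hf
  have h := (tendsto_rpow_neg_natCast_add_one (ε := 1 / 8) (by norm_num)).const_mul C
  rw [mul_zero] at h
  refine squeeze_zero (fun j => ?_) (fun j => ?_) h
  · have := ha.nonneg (j + 1)
    have := hf.nonneg N j
    positivity
  · have h1 := (mul_le_mul_of_nonneg_left (backDiff_iterate_le hf.nonneg N j)
      (ha.nonneg (j + 1))).trans (hC j).2
    have hj : (0 : ℝ) < (j : ℝ) + 1 := by positivity
    have h2 := mul_le_mul_of_nonneg_left h1 hj.le
    push_cast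
    refine h2.trans (le_of_eq ?_)
    rw [show (-(1 / 8 : ℝ)) = 1 + -(9 / 8) by norm_num, Real.rpow_add hj, Real.rpow_one]
    ring

/-- Division of `g` by the index divides the increments by `N + 1 - α`. The hypothesis `hab` is the
recursion `(j + 1) * a (j + 1) = (α + j) * a j` of `(α)_j / j!` for `α = (1 + x) / 2`, read on the
coefficients of a power of `x`, with `b` in place of `x * a`. The summands on the two sides differ
by `c j - c (j + 1)` with `c j = j * a j * backDiff^[N] f j`, up to a factor. -/
lemma newtonDiff_recursion_id_mul {a b f g : ℕ → ℝ} (ha : IsWeight a) (hb : IsWeight b)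
    (hab : ∀ j : ℕ, 2 * ((j : ℝ) + 1) * a (j + 1) = (2 * j + 1) * a j + b j)
    (hf : IsTame f) (hg : IsTame g) (hfg : ∀ i : ℕ, g i = (i : ℝ) * f i) (N : ℕ) :
    (2 * N + 1) * newtonDiff a f N = 2 * newtonValue a g (N + 1) + newtonDiff b f N := by
  have hgf : g = fun i : ℕ => (i : ℝ) * f i := funext hfg
  set c : ℕ → ℝ := fun j => (j : ℝ) * (a j * backDiff^[N] f j) with hc
  have term : ∀ j : ℕ, 2 * (c j - c (j + 1)) =
      (2 * N + 1) * (a j * backDiff^[N] f (j + 1)) + 2 * (a j * backDiff^[N + 1] g j)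
        - b j * backDiff^[N] f (j + 1) := by
    intro j
    rw [hgf, backDiff_iterate_id_mul, backDiff_iterate_succ]
    simp only [hc]; push_cast
    linear_combination (-backDiff^[N] f (j + 1)) * hab j
  have s1 := (summable_weight_mul_succ ha hf N).mul_left (2 * (N : ℝ) + 1)
  have s2 := (summable_weight_mul ha hg (N + 1)).mul_left 2
  have s3 := summable_weight_mul_succ hb hf N
  have hs := (s1.add s2).sub s3
  have hs' : Summable fun j => c j - c (j + 1) := by
    refine (hs.mul_left (1 / 2)).congr fun j => ?_
    rw [← term]; ring
  have h1 : ∑' j, 2 * (c j - c (j + 1)) = 0 := by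
    rw [tsum_mul_left, tsum_sub_succ_eq (tendsto_id_mul_weight_mul ha hf N) hs']
    simp
  rw [tsum_congr term, (s1.add s2).tsum_sub s3, s1.tsum_add s2, tsum_mul_left, tsum_mul_left] at h1
  rw [newtonDiff, newtonDiff, newtonValue]
  linarith

/-- The counterpart of `newtonDiff_recursion_id_mul` for `f` obtained from the partial sums of `g`
by division by the index; it is proved with the same telescoping series. -/
lemma newtonDiff_recursion_sum {a b f g : ℕ → ℝ} (ha : IsWeight a) (hb : IsWeight b)
    (hab : ∀ j : ℕ, 2 * ((j : ℝ) + 1) * a (j + 1) = (2 * j + 1) * a j + b j)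
    (hf : IsTame f) (hg : ∀ N, Summable fun j => a j * backDiff^[N] g (j + 1))
    (hfg : ∀ i : ℕ, g (i + 1) = ((i + 1 : ℕ) : ℝ) * f (i + 1) - i * f i) (N : ℕ) :
    (2 * N + 1) * newtonDiff a f N = 2 * newtonDiff a g N + newtonDiff b f N := by
  set c : ℕ → ℝ := fun j => (j : ℝ) * (a j * backDiff^[N] f j) with hc
  have term : ∀ j : ℕ, 2 * (c j - c (j + 1)) =
      (2 * N + 1) * (a j * backDiff^[N] f (j + 1)) - 2 * (a j * backDiff^[N] g (j + 1))
        - b j * backDiff^[N] f (j + 1) := by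
    intro j
    rw [backDiff_iterate_of_sum hfg, backDiff_iterate_succ]
    simp only [hc]; push_cast
    linear_combination (-backDiff^[N] f (j + 1)) * hab j
  have s1 := (summable_weight_mul_succ ha hf N).mul_left (2 * (N : ℝ) + 1)
  have s2 := (hg N).mul_left 2
  have s3 := summable_weight_mul_succ hb hf N
  have hs := (s1.sub s2).sub s3
  have hs' : Summable fun j => c j - c (j + 1) := by
    refine (hs.mul_left (1 / 2)).congr fun j => ?_
    rw [← term]; ring
  have h1 : ∑' j, 2 * (c j - c (j + 1)) = 0 := by
    rw [tsum_mul_left, tsum_sub_succ_eq (tendsto_id_mul_weight_mul ha hf N) hs']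
    simp
  rw [tsum_congr term, (s1.sub s2).tsum_sub s3, s1.tsum_sub s2, tsum_mul_left, tsum_mul_left] at h1
  rw [newtonDiff, newtonDiff, newtonDiff]
  linarith

/-- For `a 0 = 1` the second summand is minus the value of the Newton series at `M`, so the values
at `M - α` and at `M` are asymptotic to each other. For `a 0 = 0` the first summand alone tends to
`0`. -/
lemma tendsto_newtonValue_add {a f : ℕ → ℝ} (ha : IsWeight a) (hf : IsTame f) :
    Tendsto (fun M => newtonValue a f M + a 0 * backDiff^[M] f 0) atTop (𝓝 0) := by
  have h : ∀ M, newtonValue a f M + a 0 * backDiff^[M] f 0 =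
      -∑' j, a (j + 1) * backDiff^[M] f (j + 1) := by
    intro M
    rw [newtonValue, (summable_weight_mul ha hf M).tsum_eq_zero_add]; ring
  simp only [h]
  have hs := summable_weight_succ_mul_succ ha hf 0
  have := tendsto_tsum_of_dominated_convergence (𝓕 := atTop)
    (f := fun M j => a (j + 1) * backDiff^[M] f (j + 1)) (g := fun _ => 0) hs
    (fun j => by simpa using (hf.tendsto j).const_mul (a (j + 1)))
    (Eventually.of_forall fun M j => by
      rw [Real.norm_of_nonneg (mul_nonneg (ha.nonneg _) (hf.nonneg M j))]
      exact mul_le_mul_of_nonneg_left (backDiff_iterate_le hf.nonneg M j) (ha.nonneg _))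
  simpa using this.neg

/-! ### The weights and the coefficients of the Apéry-type series -/

/-- The coefficient of `x ^ p` in `(α)_j / j!` with `α = (1 + x) / 2`. -/
noncomputable def aperyWeight (p j : ℕ) : ℝ :=
  (j.centralBinom : ℝ) / 4 ^ j * tSum (List.replicate p 1) j

lemma tSum_nonneg (l : List ℕ) (n : ℕ) : 0 ≤ tSum l n := by
  induction l generalizing n with
  | nil => simp [tSum]
  | cons k l ih =>
    refine Finset.sum_nonneg fun j hj => mul_nonneg ?_ (ih _)
    have : (1 : ℝ) ≤ j := by exact_mod_cast (Finset.mem_Icc.1 hj).1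
    exact one_div_nonneg.2 (pow_nonneg (by linarith) _)

lemma sum_Icc_one_div_mul_le (c : ℕ → ℝ) (n d : ℕ) (hc : ∀ j ∈ Finset.Icc 1 n,
    c j ≤ 1 / (j : ℝ) * (harmonic n : ℝ) ^ d) :
    ∑ j ∈ Finset.Icc 1 n, c j ≤ (harmonic n : ℝ) ^ (d + 1) := by
  refine (Finset.sum_le_sum hc).trans (le_of_eq ?_)
  rw [← Finset.sum_mul, pow_succ', harmonic_eq_sum_Icc]
  push_cast
  simp

lemma tSum_replicate_le (p n : ℕ) : tSum (List.replicate p 1) n ≤ (harmonic n : ℝ) ^ p := by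
  induction p generalizing n with
  | zero => simp [tSum]
  | succ p ih =>
    rw [List.replicate_succ, tSum]
    refine sum_Icc_one_div_mul_le _ _ _ fun j hj => ?_
    obtain ⟨h1, h2⟩ := Finset.mem_Icc.1 hj
    have hj1 : (1 : ℝ) ≤ j := by exact_mod_cast h1
    refine mul_le_mul ?_ ((ih _).trans ?_) (tSum_nonneg _ _) (by positivity)
    · rw [pow_one]; exact one_div_le_one_div_of_le (by linarith) (by linarith)
    · exact pow_le_pow_left₀ (harmonic_real_nonneg _)
        (harmonic_real_mono ((Nat.sub_le _ _).trans h2)) _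

lemma centralBinom_div_succ (j : ℕ) :
    2 * ((j : ℝ) + 1) * (((j + 1).centralBinom : ℝ) / 4 ^ (j + 1)) =
      (2 * j + 1) * ((j.centralBinom : ℝ) / 4 ^ j) := by
  have h : ((j : ℝ) + 1) * ((j + 1).centralBinom : ℝ) = 2 * (2 * j + 1) * j.centralBinom := by
    exact_mod_cast Nat.succ_mul_centralBinom_succ j
  rw [pow_succ]
  field_simp
  linarith

lemma centralBinom_div_le (j : ℕ) :
    (j.centralBinom : ℝ) / 4 ^ j ≤ ((j : ℝ) + 1) ^ (-(1 / 2 : ℝ)) := by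
  have h : ∀ j : ℕ, ((j.centralBinom : ℝ) / 4 ^ j) ^ 2 * (2 * j + 1) ≤ 1 := by
    intro j
    induction j with
    | zero => simp
    | succ j ih =>
      have h1 := centralBinom_div_succ j
      set u := (j.centralBinom : ℝ) / 4 ^ j
      set v := ((j + 1).centralBinom : ℝ) / 4 ^ (j + 1)
      have h2 : (2 * ((j : ℝ) + 1)) ^ 2 * (v ^ 2 * (2 * (j + 1 : ℕ) + 1)) =
          (u ^ 2 * (2 * j + 1)) * ((2 * j + 1) * (2 * j + 3)) := by
        push_cast
        linear_combination (2 * ((j : ℝ) + 1) * v + (2 * j + 1) * u) * (2 * j + 3) * h1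
      have h3 : (u ^ 2 * (2 * j + 1)) * ((2 * (j : ℝ) + 1) * (2 * j + 3)) ≤
          1 * ((2 * (j : ℝ) + 1) * (2 * j + 3)) := mul_le_mul_of_nonneg_right ih (by positivity)
      have h4 : (0 : ℝ) < (2 * ((j : ℝ) + 1)) ^ 2 := by positivity
      refine le_of_mul_le_mul_left ?_ h4
      rw [h2]
      nlinarith
  have hj : (0 : ℝ) < (j : ℝ) + 1 := by positivity
  have h0 : 0 ≤ (j.centralBinom : ℝ) / 4 ^ j := by positivity
  refine le_of_sq_le_sq ?_ (by positivity)
  rw [← Real.rpow_natCast (((j : ℝ) + 1) ^ _), ← Real.rpow_mul hj.le]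
  norm_num
  rw [Real.rpow_neg_one, ← one_div, le_div_iff₀ hj]
  have := h j
  rw [div_pow] at this ⊢
  refine le_trans ?_ this
  refine mul_le_mul_of_nonneg_left ?_ (by positivity)
  linarith [Nat.cast_nonneg (α := ℝ) j]

lemma isWeight_aperyWeight (p : ℕ) : IsWeight (aperyWeight p) := by
  refine ⟨fun j => mul_nonneg (by positivity) (tSum_nonneg _ _), ?_⟩
  obtain ⟨C, -, hC⟩ := exists_harmonic_pow_le p (ε := 1 / 4) (by norm_num)
  refine ⟨C, fun j => ?_⟩
  have hj : (0 : ℝ) < (j : ℝ) + 1 := by positivity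
  calc aperyWeight p j ≤ ((j : ℝ) + 1) ^ (-(1 / 2 : ℝ)) * (C * ((j : ℝ) + 1) ^ (1 / 4 : ℝ)) :=
        mul_le_mul (centralBinom_div_le j) ((tSum_replicate_le p j).trans (hC j))
          (tSum_nonneg _ _) (by positivity)
    _ = C * ((j : ℝ) + 1) ^ (-(1 / 4 : ℝ)) := by
        rw [show (-(1 / 4 : ℝ)) = -(1 / 2) + 1 / 4 by norm_num, Real.rpow_add hj]; ring

lemma isWeight_zero : IsWeight fun _ => 0 := ⟨fun _ => le_rfl, 0, fun j => by simp⟩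

lemma aperyWeight_at_zero (p : ℕ) : aperyWeight p 0 = if p = 0 then 1 else 0 := by
  cases p <;> simp [aperyWeight, tSum, List.replicate_succ]

lemma aperyWeight_zero_succ (j : ℕ) :
    2 * ((j : ℝ) + 1) * aperyWeight 0 (j + 1) = (2 * j + 1) * aperyWeight 0 j + 0 := by
  simpa [aperyWeight, tSum] using centralBinom_div_succ j

lemma aperyWeight_succ_succ (p j : ℕ) :
    2 * ((j : ℝ) + 1) * aperyWeight (p + 1) (j + 1) =
      (2 * j + 1) * aperyWeight (p + 1) j + aperyWeight p j := by
  have h := centralBinom_div_succ j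
  have ht : tSum (List.replicate (p + 1) 1) (j + 1) = tSum (List.replicate (p + 1) 1) j +
      1 / (2 * (j : ℝ) + 1) * tSum (List.replicate p 1) j := by
    rw [List.replicate_succ, tSum, tSum, Finset.sum_Icc_succ_top (by omega)]
    push_cast
    rw [pow_one, show 2 * ((j : ℝ) + 1) - 1 = 2 * j + 1 by ring]
  rw [aperyWeight, aperyWeight, aperyWeight, ht, ← mul_assoc, h]
  field_simp

/-- The summand of index `n` of the star sum with leading exponent `m` and remaining exponents
`k`; its value at `0` is `0`. -/
noncomputable def starTerm (m : ℕ) (k : List ℕ) (n : ℕ) : ℝ :=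
  1 / (n : ℝ) ^ m * zetaStarSum k n

lemma zetaStarSum_nonneg (l : List ℕ) (n : ℕ) : 0 ≤ zetaStarSum l n := by
  induction l generalizing n with
  | nil => simp [zetaStarSum]
  | cons k l ih => exact Finset.sum_nonneg fun j hj => mul_nonneg (by positivity) (ih _)

lemma zetaStarSum_le (l : List ℕ) (hl : ∀ a ∈ l, 1 ≤ a) (n : ℕ) :
    zetaStarSum l n ≤ (harmonic n : ℝ) ^ l.length := by
  induction l generalizing n with
  | nil => simp [zetaStarSum]
  | cons k l ih =>
    rw [zetaStarSum]
    refine sum_Icc_one_div_mul_le _ _ _ fun j hj => ?_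
    obtain ⟨h1, h2⟩ := Finset.mem_Icc.1 hj
    have hj1 : (1 : ℝ) ≤ j := by exact_mod_cast h1
    refine mul_le_mul ?_ ((ih (fun a ha => hl a (by simp [ha])) _).trans ?_)
      (zetaStarSum_nonneg _ _) (by positivity)
    · exact one_div_le_one_div_of_le (by linarith)
        (le_self_pow₀ hj1 (by have := hl k (by simp); omega))
    · exact pow_le_pow_left₀ (harmonic_real_nonneg _) (harmonic_real_mono h2) _

lemma starTerm_decay {m : ℕ} (hm : 1 ≤ m) {k : List ℕ} (hk : ∀ a ∈ k, 1 ≤ a) :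
    ∃ C, ∀ j : ℕ, starTerm m k (j + 1) ≤ C * ((j : ℝ) + 1) ^ (-(7 / 8 : ℝ)) := by
  obtain ⟨C, hC0, hC⟩ := exists_harmonic_pow_le k.length (ε := 1 / 8) (by norm_num)
  refine ⟨C * 2 ^ (1 / 8 : ℝ), fun j => ?_⟩
  have hj : (0 : ℝ) < (j : ℝ) + 1 := by positivity
  have hj1 : (1 : ℝ) ≤ (j : ℝ) + 1 := by linarith [Nat.cast_nonneg (α := ℝ) j]
  have h1 : zetaStarSum k (j + 1) ≤ C * (2 ^ (1 / 8 : ℝ) * ((j : ℝ) + 1) ^ (1 / 8 : ℝ)) := by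
    refine (zetaStarSum_le k hk _).trans ((hC _).trans (mul_le_mul_of_nonneg_left ?_ hC0.le))
    rw [← Real.mul_rpow (by norm_num) hj.le]
    push_cast
    exact Real.rpow_le_rpow (by positivity) (by linarith) (by norm_num)
  have h2 : 1 / ((j + 1 : ℕ) : ℝ) ^ m ≤ ((j : ℝ) + 1) ^ (-1 : ℝ) := by
    rw [Real.rpow_neg_one, ← one_div]
    push_cast
    exact one_div_le_one_div_of_le hj (le_self_pow₀ hj1 (by omega))
  refine (mul_le_mul h2 h1 (zetaStarSum_nonneg _ _) (by positivity)).trans (le_of_eq ?_)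
  rw [show (-(7 / 8 : ℝ)) = -1 + 1 / 8 by norm_num, Real.rpow_add hj]; ring

lemma starTerm_zero {m : ℕ} (hm : 1 ≤ m) (k : List ℕ) : starTerm m k 0 = 0 := by
  have : m ≠ 0 := by omega
  simp [starTerm, this]

lemma starTerm_eq_id_mul (m : ℕ) (hm : 1 ≤ m) (k : List ℕ) (i : ℕ) :
    starTerm m k i = (i : ℝ) * starTerm (m + 1) k i := by
  rcases Nat.eq_zero_or_pos i with rfl | h
  · simp [starTerm_zero hm]
  · have : (i : ℝ) ≠ 0 := by positivity
    rw [starTerm, starTerm, pow_succ]; field_simp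

lemma starTerm_one_cons (m : ℕ) (k : List ℕ) (i : ℕ) :
    starTerm m k (i + 1) =
      ((i + 1 : ℕ) : ℝ) * starTerm 1 (m :: k) (i + 1) - i * starTerm 1 (m :: k) i := by
  have h : ∀ i : ℕ, (i : ℝ) * starTerm 1 (m :: k) i = zetaStarSum (m :: k) i := by
    intro i
    rcases Nat.eq_zero_or_pos i with rfl | h
    · simp [zetaStarSum]
    · have : (i : ℝ) ≠ 0 := by positivity
      rw [starTerm, pow_one]; field_simp
  rw [h, h, zetaStarSum, Finset.sum_Icc_succ_top (by omega), starTerm]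
  simp [zetaStarSum]

/-- The indicator sequence of `1`, in the role of the star summand of the empty composition. -/
def unitTerm (j : ℕ) : ℝ := if j = 1 then 1 else 0

lemma unitTerm_eq (i : ℕ) :
    unitTerm (i + 1) = ((i + 1 : ℕ) : ℝ) * starTerm 1 [] (i + 1) - i * starTerm 1 [] i := by
  rcases Nat.eq_zero_or_pos i with rfl | h
  · simp [unitTerm, starTerm, zetaStarSum]
  · have h1 : (i : ℝ) ≠ 0 := by positivity
    have h2 : (i : ℝ) + 1 ≠ 0 := by positivity
    simp [unitTerm, starTerm, zetaStarSum, h.ne', h1, h2]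

lemma backDiff_iterate_unitTerm (N j : ℕ) :
    backDiff^[N] unitTerm (j + 1) = if j = 0 then 1 else 0 := by
  induction N generalizing j with
  | zero => simp [unitTerm]
  | succ N ih => rw [backDiff_iterate_succ, ih, ih]; simp

lemma isTame_starTerm {m : ℕ} (hm : 1 ≤ m) {k : List ℕ} (hk : ∀ a ∈ k, 1 ≤ a) :
    IsTame (starTerm m k) := by
  induction k generalizing m with
  | nil =>
    induction m, hm using Nat.le_induction with
    | base =>
      exact IsTame.of_sum (g := unitTerm)
        (fun N j => by rw [backDiff_iterate_unitTerm]; split_ifs <;> norm_num) unitTerm_eq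
        (starTerm_zero le_rfl _) (starTerm_decay le_rfl hk)
    | succ m hm ih =>
      exact ih.of_id_mul (starTerm_eq_id_mul m hm _) (starTerm_zero (by omega) _)
  | cons k₁ k ihk =>
    have hk1 : 1 ≤ k₁ := hk k₁ (by simp)
    have hk' : ∀ a ∈ k, 1 ≤ a := fun a ha => hk a (by simp [ha])
    induction m, hm using Nat.le_induction with
    | base =>
      exact IsTame.of_sum (ihk hk1 hk').nonneg (starTerm_one_cons k₁ k)
        (starTerm_zero le_rfl _) (starTerm_decay le_rfl hk)
    | succ m hm ih =>
      exact ih.of_id_mul (starTerm_eq_id_mul m hm _) (starTerm_zero (by omega) _)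

/-! ### Words and the operators that build nested sums -/

/-- The operator `f ↦ (N ↦ ∑_{n ≤ N} z ^ n / n ^ k * f (n - 1))`, which prepends the letter `(k, z)`
to the index of a truncated colored sum. -/
noncomputable def nestSum (k : ℕ) (z : ℂ) : (ℕ → ℂ) →ₗ[ℚ] (ℕ → ℂ) where
  toFun f N := ∑ n ∈ Finset.Icc 1 N, z ^ n / (n : ℂ) ^ k * f (n - 1)
  map_add' f g := by ext N; simp [mul_add, Finset.sum_add_distrib]
  map_smul' q f := by ext N; simp [Finset.smul_sum]

lemma nestSum_at_zero (k : ℕ) (z : ℂ) (f : ℕ → ℂ) : nestSum k z f 0 = 0 := by simp [nestSum]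

lemma nestSum_at_succ (k : ℕ) (z : ℂ) (f : ℕ → ℂ) (N : ℕ) :
    nestSum k z f (N + 1) = nestSum k z f N + z ^ (N + 1) / ((N : ℂ) + 1) ^ k * f N := by
  simp [nestSum, Finset.sum_Icc_succ_top]

lemma coloredSum_nil : coloredSum [] = 1 := rfl

lemma coloredSum_cons (c : ℕ × ℂ) (cs : List (ℕ × ℂ)) :
    coloredSum (c :: cs) = nestSum c.1 c.2 (coloredSum cs) := rfl

/-- The quasi-shuffle recursion for products of nested sums. -/
lemma nestSum_mul_nestSum (k l : ℕ) (y z : ℂ) (f g : ℕ → ℂ) :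
    nestSum k y f * nestSum l z g = nestSum k y (f * nestSum l z g) +
      nestSum l z (nestSum k y f * g) + nestSum (k + l) (y * z) (f * g) := by
  ext N
  induction N with
  | zero => simp [nestSum_at_zero]
  | succ N ih =>
    simp only [Pi.add_apply, Pi.mul_apply, nestSum_at_succ] at ih ⊢
    rw [pow_add _ k l, mul_pow, mul_div_mul_comm]
    linear_combination ih

/-- A sequence of letters `(k, z)` with `k ≥ 1` and `z = ±1`, possibly empty and possibly
non-admissible. -/
def IsWord (c : List (ℕ × ℂ)) : Prop := ∀ a ∈ c, 1 ≤ a.1 ∧ a.2 ^ 2 = 1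

/-- The weight of a word. -/
def wordWeight (c : List (ℕ × ℂ)) : ℕ := (c.map Prod.fst).sum

lemma wordWeight_cons (a : ℕ × ℂ) (c : List (ℕ × ℂ)) :
    wordWeight (a :: c) = a.1 + wordWeight c := by simp [wordWeight]

lemma isWord_cons {a : ℕ × ℂ} {c : List (ℕ × ℂ)} :
    IsWord (a :: c) ↔ (1 ≤ a.1 ∧ a.2 ^ 2 = 1) ∧ IsWord c := by simp [IsWord]

lemma isWord_nil : IsWord [] := by simp [IsWord]

/-- The `ℚ`-span of the truncated colored sums of level `2` and weight `w`, as functions of the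
truncation. -/
noncomputable def wordSpan (w : ℕ) : Submodule ℚ (ℕ → ℂ) :=
  Submodule.span ℚ {f | ∃ c, IsWord c ∧ wordWeight c = w ∧ f = coloredSum c}

/-- The span of the truncated sums of weight `w` whose words start with at most `k` letters
`(1, 1)`. -/
noncomputable def leadSpan (k w : ℕ) : Submodule ℚ (ℕ → ℂ) :=
  Submodule.span ℚ {f | ∃ j c, j ≤ k ∧ IsWord c ∧ c.head? ≠ some (1, 1) ∧ j + wordWeight c = w ∧
    f = coloredSum (List.replicate j (1, 1) ++ c)}

lemma coloredSum_mem_wordSpan {c : List (ℕ × ℂ)} (hc : IsWord c) :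
    coloredSum c ∈ wordSpan (wordWeight c) := Submodule.subset_span ⟨c, hc, rfl, rfl⟩

lemma leadSpan_mono {k l w : ℕ} (h : k ≤ l) : leadSpan k w ≤ leadSpan l w := by
  refine Submodule.span_mono ?_
  rintro _ ⟨j, c, hj, hc⟩
  exact ⟨j, c, hj.trans h, hc⟩

lemma nestSum_mem_wordSpan {k w v : ℕ} {z : ℂ} {f : ℕ → ℂ} (hk : 1 ≤ k) (hz : z ^ 2 = 1)
    (hv : k + w = v) (hf : f ∈ wordSpan w) : nestSum k z f ∈ wordSpan v := by
  suffices h : wordSpan w ≤ (wordSpan v).comap (nestSum k z) from h hf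
  refine Submodule.span_le.2 ?_
  rintro _ ⟨c, hc, rfl, rfl⟩
  exact Submodule.subset_span ⟨(k, z) :: c, isWord_cons.2 ⟨⟨hk, hz⟩, hc⟩,
    by rw [wordWeight_cons, hv], rfl⟩

lemma nestSum_mem_leadSpan_zero {k w v : ℕ} {z : ℂ} {f : ℕ → ℂ} (hk : 1 ≤ k) (hz : z ^ 2 = 1)
    (hkz : (k, z) ≠ (1, 1)) (hv : k + w = v) (hf : f ∈ wordSpan w) :
    nestSum k z f ∈ leadSpan 0 v := by
  suffices h : wordSpan w ≤ (leadSpan 0 v).comap (nestSum k z) from h hf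
  refine Submodule.span_le.2 ?_
  rintro _ ⟨c, hc, rfl, rfl⟩
  exact Submodule.subset_span ⟨0, (k, z) :: c, le_rfl, isWord_cons.2 ⟨⟨hk, hz⟩, hc⟩,
    by simpa using hkz, by rw [wordWeight_cons, zero_add, hv], rfl⟩

lemma nestSum_one_mem_leadSpan {k w : ℕ} {f : ℕ → ℂ} (hf : f ∈ leadSpan k w) :
    nestSum 1 1 f ∈ leadSpan (k + 1) (w + 1) := by
  suffices h : leadSpan k w ≤ (leadSpan (k + 1) (w + 1)).comap (nestSum 1 1) from h hf
  refine Submodule.span_le.2 ?_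
  rintro _ ⟨j, c, hj, hc, hh, rfl, rfl⟩
  exact Submodule.subset_span ⟨j + 1, c, by omega, hc, hh, by omega, rfl⟩

lemma coloredSum_mul_mem_wordSpan {a b : List (ℕ × ℂ)} (ha : IsWord a) (hb : IsWord b) :
    coloredSum a * coloredSum b ∈ wordSpan (wordWeight a + wordWeight b) := by
  induction a generalizing b with
  | nil => simpa [coloredSum_nil, wordWeight] using coloredSum_mem_wordSpan hb
  | cons c cs iha =>
    induction b with
    | nil => simpa [coloredSum_nil, wordWeight] using coloredSum_mem_wordSpan ha
    | cons d ds ihb =>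
      obtain ⟨⟨hc1, hc2⟩, hcs⟩ := isWord_cons.1 ha
      obtain ⟨⟨hd1, hd2⟩, hds⟩ := isWord_cons.1 hb
      rw [coloredSum_cons, coloredSum_cons, nestSum_mul_nestSum, ← coloredSum_cons,
        ← coloredSum_cons]
      refine add_mem (add_mem ?_ ?_) ?_
      · exact nestSum_mem_wordSpan hc1 hc2 (by simp only [wordWeight_cons]; ring) (iha hcs hb)
      · exact nestSum_mem_wordSpan hd1 hd2 (by simp only [wordWeight_cons]; ring) (ihb hds)
      · exact nestSum_mem_wordSpan (by omega) (by rw [mul_pow, hc2, hd2, one_mul])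
          (by simp only [wordWeight_cons]; ring) (iha hcs hds)

/-- A stuffle product of regular words has only regular terms: the leading letter is that of one of
the factors, or it has exponent at least `2`. -/
lemma coloredSum_mul_mem_leadSpan_zero {a b : List (ℕ × ℂ)} (ha : IsWord a) (hb : IsWord b)
    (ha' : a.head? ≠ some (1, 1)) (hb' : b.head? ≠ some (1, 1)) :
    coloredSum a * coloredSum b ∈ leadSpan 0 (wordWeight a + wordWeight b) := by
  rcases a with _ | ⟨c, cs⟩
  · exact Submodule.subset_span ⟨0, b, le_rfl, hb, hb', by simp [wordWeight],
      by simp [coloredSum_nil]⟩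
  rcases b with _ | ⟨d, ds⟩
  · exact Submodule.subset_span ⟨0, _, le_rfl, ha, ha', by simp [wordWeight],
      by simp [coloredSum_nil]⟩
  have hc' : (c.1, c.2) ≠ (1, 1) := by simpa using ha'
  have hd' : (d.1, d.2) ≠ (1, 1) := by simpa using hb'
  obtain ⟨⟨hc1, hc2⟩, hcs⟩ := isWord_cons.1 ha
  obtain ⟨⟨hd1, hd2⟩, hds⟩ := isWord_cons.1 hb
  rw [coloredSum_cons, coloredSum_cons, nestSum_mul_nestSum, ← coloredSum_cons, ← coloredSum_cons]
  refine add_mem (add_mem ?_ ?_) ?_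
  · exact nestSum_mem_leadSpan_zero hc1 hc2 hc' (by simp only [wordWeight_cons]; ring)
      (coloredSum_mul_mem_wordSpan hcs hb)
  · exact nestSum_mem_leadSpan_zero hd1 hd2 hd' (by simp only [wordWeight_cons]; ring)
      (coloredSum_mul_mem_wordSpan ha hds)
  · refine nestSum_mem_leadSpan_zero (by omega) (by rw [mul_pow, hc2, hd2, one_mul]) ?_
      (by simp only [wordWeight_cons]; ring) (coloredSum_mul_mem_wordSpan hcs hds)
    intro h
    have := congrArg Prod.fst h
    simp only at this
    omega

/-! ### Convergence of regular truncated sums -/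

lemma norm_eq_one_of_sq {z : ℂ} (hz : z ^ 2 = 1) : ‖z‖ = 1 :=
  Complex.norm_eq_one_of_pow_eq_one hz two_ne_zero

lemma norm_coloredSum_le {c : List (ℕ × ℂ)} (hc : IsWord c) (n : ℕ) :
    ‖coloredSum c n‖ ≤ (harmonic n : ℝ) ^ c.length := by
  induction c generalizing n with
  | nil => simp [coloredSum]
  | cons a c ih =>
    obtain ⟨⟨h1, h2⟩, h3⟩ := isWord_cons.1 hc
    rw [coloredSum]
    refine (norm_sum_le _ _).trans (sum_Icc_one_div_mul_le _ _ _ fun j hj => ?_)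
    obtain ⟨hj1, hj2⟩ := Finset.mem_Icc.1 hj
    have hj0 : (1 : ℝ) ≤ j := by exact_mod_cast hj1
    rw [norm_mul, norm_div, norm_pow, norm_pow, norm_eq_one_of_sq h2, one_pow, Complex.norm_natCast]
    refine mul_le_mul ?_ ((ih h3 _).trans ?_) (norm_nonneg _) (by positivity)
    · exact one_div_le_one_div_of_le (by linarith) (le_self_pow₀ hj0 (by omega))
    · exact pow_le_pow_left₀ (harmonic_real_nonneg _)
        (harmonic_real_mono ((Nat.sub_le _ _).trans hj2)) _

lemma exists_norm_coloredSum_le {c : List (ℕ × ℂ)} (hc : IsWord c) :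
    ∃ C : ℝ, 0 ≤ C ∧ ∀ n : ℕ, ‖coloredSum c n‖ ≤ C * ((n : ℝ) + 1) ^ (1 / 2 : ℝ) := by
  obtain ⟨C, h0, hC⟩ := exists_harmonic_pow_le c.length (ε := 1 / 2) (by norm_num)
  exact ⟨C, h0.le, fun n => (norm_coloredSum_le hc n).trans (hC n)⟩

lemma norm_coloredSum_succ_sub {a : ℕ × ℂ} {c : List (ℕ × ℂ)} (ha : a.2 ^ 2 = 1) (n : ℕ) :
    ‖coloredSum (a :: c) (n + 1) - coloredSum (a :: c) n‖ =
      ‖coloredSum c n‖ / ((n : ℝ) + 1) ^ a.1 := by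
  have hn : ‖(n : ℂ) + 1‖ = (n : ℝ) + 1 := by
    rw [← Nat.cast_add_one, Complex.norm_natCast]; push_cast; rfl
  rw [coloredSum_cons, nestSum_at_succ, add_sub_cancel_left, norm_mul, norm_div, norm_pow, norm_pow,
    norm_eq_one_of_sq ha, hn, one_pow]
  ring

lemma exists_norm_coloredSum_succ_sub_le {c : List (ℕ × ℂ)} (hc : IsWord c) :
    ∃ C : ℝ, 0 ≤ C ∧ ∀ n : ℕ, ‖coloredSum c (n + 1) - coloredSum c n‖ ≤
      C * ((n : ℝ) + 1) ^ (-(1 / 2) : ℝ) := by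
  rcases c with _ | ⟨a, c⟩
  · exact ⟨0, le_rfl, fun n => by simp [coloredSum]⟩
  obtain ⟨⟨h1, h2⟩, h3⟩ := isWord_cons.1 hc
  obtain ⟨C, h0, hC⟩ := exists_norm_coloredSum_le h3
  refine ⟨C, h0, fun n => ?_⟩
  have hn : (0 : ℝ) < (n : ℝ) + 1 := by positivity
  have hn1 : (1 : ℝ) ≤ (n : ℝ) + 1 := by linarith [Nat.cast_nonneg (α := ℝ) n]
  rw [norm_coloredSum_succ_sub h2, show (-(1 / 2) : ℝ) = 1 / 2 - 1 by norm_num,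
    Real.rpow_sub_one hn.ne', ← mul_div_assoc]
  exact div_le_div₀ (by positivity) (hC n) hn (le_self_pow₀ hn1 (by omega))

lemma rpow_neg_three_halves_le {x : ℝ} (hx : 1 ≤ x) :
    x ^ (-(3 / 2) : ℝ) ≤ 4 * (x ^ (-(1 / 2) : ℝ) - (x + 1) ^ (-(1 / 2) : ℝ)) := by
  have hx0 : 0 < x := by linarith
  have e1 : ∀ y : ℝ, 0 < y → y ^ (-(1 / 2) : ℝ) = (√y)⁻¹ := fun y hy => by
    rw [Real.rpow_neg hy.le, Real.sqrt_eq_rpow]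
  rw [show (-(3 / 2) : ℝ) = -(1 / 2) - 1 by norm_num, Real.rpow_sub_one hx0.ne', e1 x hx0,
    e1 (x + 1) (by linarith)]
  have hs : √x ^ 2 = x := Real.sq_sqrt hx0.le
  have ht : √(x + 1) ^ 2 = x + 1 := Real.sq_sqrt (by linarith)
  have hs0 : 0 < √x := Real.sqrt_pos.2 hx0
  have ht0 : 0 < √(x + 1) := Real.sqrt_pos.2 (by linarith)
  set s := √x
  set t := √(x + 1)
  have hts : t ≤ 3 / 2 * s := by
    refine le_of_sq_le_sq ?_ (by positivity)
    nlinarith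
  have hd : t - s = 1 / (t + s) := by
    rw [eq_div_iff (by positivity)]; nlinarith
  have h1 : s⁻¹ - t⁻¹ = 1 / ((t + s) * (s * t)) := by
    rw [inv_sub_inv hs0.ne' ht0.ne', hd]; field_simp
  rw [h1, ← hs, mul_one_div, inv_eq_one_div, div_div,
    div_le_div_iff₀ (by positivity) (by positivity)]
  have h2 : (t + s) * t ≤ 4 * s ^ 2 := by nlinarith
  nlinarith

lemma exists_norm_sub_le_of_increments {u : ℕ → ℂ} {C : ℝ}
    (hu : ∀ n : ℕ, ‖u (n + 1) - u n‖ ≤ C * ((n : ℝ) + 1) ^ (-(3 / 2) : ℝ)) :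
    ∃ v : ℂ, ∀ n : ℕ, ‖u n - v‖ ≤ 4 * C * ((n : ℝ) + 1) ^ (-(1 / 2) : ℝ) := by
  have hC : 0 ≤ C := by simpa using (norm_nonneg _).trans (hu 0)
  set g : ℕ → ℝ := fun n => 4 * C * ((n : ℝ) + 1) ^ (-(1 / 2) : ℝ) with hg
  have hstep : ∀ n, ‖u (n + 1) - u n‖ ≤ g n - g (n + 1) := by
    intro n
    refine (hu n).trans ?_
    have := mul_le_mul_of_nonneg_left
      (rpow_neg_three_halves_le (x := (n : ℝ) + 1) (by linarith [Nat.cast_nonneg (α := ℝ) n])) hC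
    simp only [hg]; push_cast
    linarith
  have hdist : ∀ n k, ‖u (n + k) - u n‖ ≤ g n - g (n + k) := by
    intro n k
    induction k with
    | zero => simp
    | succ k ih =>
      have h1 := hstep (n + k)
      have h2 := norm_add_le (u (n + k + 1) - u (n + k)) (u (n + k) - u n)
      rw [sub_add_sub_cancel] at h2
      rw [← add_assoc]
      linarith
  have hg0 : ∀ n, 0 ≤ g n := fun n => by simp only [hg]; positivity
  have hglim : Tendsto g atTop (𝓝 0) := by
    have := (tendsto_rpow_neg_natCast_add_one (ε := 1 / 2) (by norm_num)).const_mul (4 * C)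
    rwa [mul_zero] at this
  have hcauchy : CauchySeq u := by
    refine cauchySeq_of_le_tendsto_0' g (fun n m hnm => ?_) hglim
    obtain ⟨k, rfl⟩ := Nat.exists_eq_add_of_le hnm
    rw [dist_comm, dist_eq_norm]
    linarith [hdist n k, hg0 (n + k)]
  obtain ⟨v, hv⟩ := cauchySeq_tendsto_of_complete hcauchy
  refine ⟨v, fun n => ?_⟩
  have h1 : Tendsto (fun k => ‖u n - u (n + k)‖) atTop (𝓝 ‖u n - v‖) := by
    refine (tendsto_const_nhds.sub ?_).norm
    have := (tendsto_add_atTop_iff_nat n).2 hv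
    simpa [add_comm] using this
  refine le_of_tendsto' h1 fun k => ?_
  rw [norm_sub_rev]
  linarith [hdist n k, hg0 (n + k)]

/-- Truncations of admissible colored sums converge at a polynomial rate. In the conditionally
convergent case, half of the alternating boundary term is split off; the increments of what is left
are absolutely summable. -/
lemma exists_norm_coloredSum_sub_le {c : List (ℕ × ℂ)} (hc : IsWord c)
    (hc' : c.head? ≠ some (1, 1)) :
    ∃ (v : ℂ) (C : ℝ), ∀ n : ℕ, ‖coloredSum c n - v‖ ≤ C * ((n : ℝ) + 1) ^ (-(1 / 2) : ℝ) := by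
  rcases c with _ | ⟨⟨k, z⟩, c⟩
  · exact ⟨1, 0, fun n => by simp [coloredSum]⟩
  obtain ⟨⟨h1, h2⟩, h3⟩ := isWord_cons.1 hc
  simp only at h1 h2
  obtain ⟨C, hC0, hC⟩ := exists_norm_coloredSum_le h3
  have hpow : ∀ n : ℕ, ((n : ℝ) + 1) ^ (-(3 / 2) : ℝ) =
      ((n : ℝ) + 1) ^ (1 / 2 : ℝ) / ((n : ℝ) + 1) ^ 2 := fun n => by
    have hn : (0 : ℝ) < (n : ℝ) + 1 := by positivity
    rw [show (-(3 / 2) : ℝ) = 1 / 2 - (2 : ℕ) by norm_num, Real.rpow_sub_natCast hn.ne']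
  rcases Nat.lt_or_ge 1 k with hk | hk
  · obtain ⟨v, hv⟩ := exists_norm_sub_le_of_increments (u := coloredSum ((k, z) :: c)) (C := C)
      fun n => by
        have hn1 : (1 : ℝ) ≤ (n : ℝ) + 1 := by linarith [Nat.cast_nonneg (α := ℝ) n]
        rw [norm_coloredSum_succ_sub h2, hpow, ← mul_div_assoc]
        exact div_le_div₀ (by positivity) (hC n) (by positivity) (pow_le_pow_right₀ hn1 hk)
    exact ⟨v, 4 * C, hv⟩
  obtain rfl : k = 1 := by omega
  obtain rfl : z = -1 := by
    rcases sq_eq_one_iff.1 h2 with h | h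
    · simp [h] at hc'
    · exact h
  obtain ⟨D, hD0, hD⟩ := exists_norm_coloredSum_succ_sub_le h3
  set f := coloredSum c
  set h : ℕ → ℂ := fun n => (-1) ^ n * (f n / (2 * ((n : ℂ) + 1))) with hh
  have hinc : ∀ n : ℕ, ‖(coloredSum ((1, -1) :: c) (n + 1) - h (n + 1)) -
      (coloredSum ((1, -1) :: c) n - h n)‖ ≤ (C + D) * ((n : ℝ) + 1) ^ (-(3 / 2) : ℝ) := by
    intro n
    have hn : (0 : ℝ) < (n : ℝ) + 1 := by positivity
    have hn1 : (n : ℂ) + 1 ≠ 0 := by exact_mod_cast hn.ne'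
    have hn2 : (n : ℂ) + 1 + 1 ≠ 0 := by
      have : ((n : ℝ) + 1 + 1) ≠ 0 := by positivity
      exact_mod_cast this
    have e : (coloredSum ((1, -1) :: c) (n + 1) - h (n + 1)) -
        (coloredSum ((1, -1) :: c) n - h n) = (-1) ^ (n + 1) *
          (f n / (2 * (((n : ℂ) + 1) * ((n : ℂ) + 1 + 1))) -
            (f (n + 1) - f n) / (2 * ((n : ℂ) + 1 + 1))) := by
      rw [coloredSum_cons, nestSum_at_succ]
      simp only [hh, pow_succ]
      push_cast
      field_simp
      ring
    have nn1 : ‖(n : ℂ) + 1‖ = (n : ℝ) + 1 := by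
      rw [← Nat.cast_add_one, Complex.norm_natCast]; push_cast; rfl
    have nn2 : ‖(n : ℂ) + 1 + 1‖ = (n : ℝ) + 1 + 1 := by
      rw [← Nat.cast_add_one, ← Nat.cast_add_one, Complex.norm_natCast]; push_cast; rfl
    rw [e, norm_mul, norm_pow, norm_neg, norm_one, one_pow, one_mul]
    refine (norm_sub_le _ _).trans ?_
    rw [norm_div, norm_div, norm_mul, norm_mul, norm_mul, nn1, nn2, Complex.norm_ofNat, add_mul C D]
    refine add_le_add ?_ ?_
    · rw [hpow, ← mul_div_assoc]
      exact div_le_div₀ (by positivity) (hC n) (by positivity) (by nlinarith)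
    · rw [show (-(3 / 2) : ℝ) = -(1 / 2) - 1 by norm_num, Real.rpow_sub_one hn.ne',
        ← mul_div_assoc]
      exact div_le_div₀ (by positivity) (hD n) (by positivity) (by nlinarith)
  obtain ⟨v, hv⟩ := exists_norm_sub_le_of_increments
    (u := fun n => coloredSum ((1, -1) :: c) n - h n) hinc
  refine ⟨v, 4 * (C + D) + C, fun n => ?_⟩
  have hn : (0 : ℝ) < (n : ℝ) + 1 := by positivity
  have h4 : ‖h n‖ ≤ C * ((n : ℝ) + 1) ^ (-(1 / 2) : ℝ) := by
    have nn1 : ‖(n : ℂ) + 1‖ = (n : ℝ) + 1 := by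
      rw [← Nat.cast_add_one, Complex.norm_natCast]; push_cast; rfl
    simp only [hh]
    rw [norm_mul, norm_pow, norm_neg, norm_one, one_pow, one_mul, norm_div, norm_mul, nn1,
      Complex.norm_ofNat, show (-(1 / 2) : ℝ) = 1 / 2 - 1 by norm_num, Real.rpow_sub_one hn.ne',
      ← mul_div_assoc]
    exact div_le_div₀ (by positivity) (hC n) hn (by linarith)
  calc ‖coloredSum ((1, -1) :: c) n - v‖
      = ‖(coloredSum ((1, -1) :: c) n - h n - v) + h n‖ := by congr 1; ring
    _ ≤ _ := (norm_add_le _ _).trans (add_le_add (hv n) h4)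
    _ = _ := by ring

/-! ### Spans of limits -/

/-- The `ℚ`-span of the limits of regular truncated sums of weight `w`. The empty word is allowed,
so this is `ℚ` for `w = 0` and the span of the colored multiple zeta values for `w ≥ 1`. -/
noncomputable def limitSpan (w : ℕ) : Submodule ℚ ℂ :=
  Submodule.span ℚ {v | ∃ c, IsWord c ∧ c.head? ≠ some (1, 1) ∧ wordWeight c = w ∧
    Tendsto (coloredSum c) atTop (𝓝 v)}

lemma limitSpan_le_cmzvSpan {w : ℕ} (hw : 1 ≤ w) : limitSpan w ≤ cmzvSpan 2 w := by
  refine Submodule.span_mono ?_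
  rintro v ⟨c, hc, hh, rfl, hv⟩
  refine ⟨c, ⟨?_, hc, hh⟩, rfl, hv⟩
  rintro rfl
  simp [wordWeight] at hw

lemma one_mem_limitSpan : (1 : ℂ) ∈ limitSpan 0 :=
  Submodule.subset_span ⟨[], isWord_nil, by simp, rfl, tendsto_const_nhds⟩

lemma tendsto_of_norm_sub_le {u : ℕ → ℂ} {v : ℂ} {C : ℝ}
    (h : ∀ n : ℕ, ‖u n - v‖ ≤ C * ((n : ℝ) + 1) ^ (-(1 / 2) : ℝ)) : Tendsto u atTop (𝓝 v) := by
  rw [tendsto_iff_norm_sub_tendsto_zero]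
  refine squeeze_zero (fun n => norm_nonneg _) h ?_
  have := (tendsto_rpow_neg_natCast_add_one (ε := 1 / 2) (by norm_num)).const_mul C
  rwa [mul_zero] at this

lemma exists_tendsto_of_mem_leadSpan_zero {w : ℕ} {f : ℕ → ℂ} (hf : f ∈ leadSpan 0 w) :
    ∃ v ∈ limitSpan w, Tendsto f atTop (𝓝 v) := by
  induction hf using Submodule.span_induction with
  | mem f h =>
    obtain ⟨j, c, hj, hc, hh, rfl, rfl⟩ := h
    obtain rfl : j = 0 := by omega
    obtain ⟨v, C, hv⟩ := exists_norm_coloredSum_sub_le hc hh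
    have := tendsto_of_norm_sub_le hv
    exact ⟨v, Submodule.subset_span ⟨c, hc, hh, by simp, this⟩, this⟩
  | zero => exact ⟨0, zero_mem _, tendsto_const_nhds⟩
  | add f g _ _ ihf ihg =>
    obtain ⟨v, hv, hv'⟩ := ihf
    obtain ⟨u, hu, hu'⟩ := ihg
    exact ⟨v + u, add_mem hv hu, hv'.add hu'⟩
  | smul q f _ ih =>
    obtain ⟨v, hv, hv'⟩ := ih
    exact ⟨q • v, Submodule.smul_mem _ _ hv, hv'.const_smul q⟩

lemma mul_mem_limitSpan {i j : ℕ} {u v : ℂ} (hu : u ∈ limitSpan i) (hv : v ∈ limitSpan j) :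
    u * v ∈ limitSpan (i + j) := by
  suffices h : limitSpan i * limitSpan j ≤ limitSpan (i + j) from h (Submodule.mul_mem_mul hu hv)
  rw [limitSpan, limitSpan, Submodule.span_mul_span, Submodule.span_le]
  rintro _ ⟨u, ⟨a, ha, ha', rfl, hau⟩, v, ⟨b, hb, hb', rfl, hbv⟩, rfl⟩
  obtain ⟨x, hx, hx'⟩ := exists_tendsto_of_mem_leadSpan_zero
    (coloredSum_mul_mem_leadSpan_zero ha hb ha' hb')
  have e : u * v = x := tendsto_nhds_unique (hau.mul hbv) hx'
  rwa [← e] at hx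

/-! ### Regularization -/

/-- The sequences which, up to an error smaller than every negative power of the harmonic numbers
`H_N`, are polynomials in `H_N` whose constant coefficient lies in `limitSpan w`. -/
noncomputable def logAsymp (w : ℕ) : Submodule ℚ (ℕ → ℂ) where
  carrier := {f | ∃ Q : Polynomial ℂ, Q.coeff 0 ∈ limitSpan w ∧
    ∀ k : ℕ, Tendsto (fun N => (harmonic N : ℂ) ^ k * (f N - Q.eval (harmonic N : ℂ))) atTop (𝓝 0)}
  zero_mem' := ⟨0, by simp, fun k => by simp⟩
  add_mem' := by
    rintro f g ⟨P, hP, hP'⟩ ⟨Q, hQ, hQ'⟩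
    refine ⟨P + Q, by simpa using add_mem hP hQ, fun k => ?_⟩
    have := (hP' k).add (hQ' k)
    rw [add_zero] at this
    refine this.congr fun N => ?_
    simp only [Pi.add_apply, Polynomial.eval_add]; ring
  smul_mem' := by
    rintro q f ⟨P, hP, hP'⟩
    refine ⟨q • P, by simpa using Submodule.smul_mem _ q hP, fun k => ?_⟩
    have := (hP' k).const_smul q
    rw [smul_zero] at this
    refine this.congr fun N => ?_
    simp only [Pi.smul_apply, Polynomial.eval_smul, mul_smul_comm, ← smul_sub]

/-- Multiplication by `H_N` makes the constant coefficient zero, so `v` is arbitrary. -/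
lemma harmonic_mul_mem_logAsymp {w v : ℕ} {f : ℕ → ℂ} (hf : f ∈ logAsymp w) :
    (fun N => (harmonic N : ℂ)) * f ∈ logAsymp v := by
  obtain ⟨Q, -, h⟩ := hf
  refine ⟨Polynomial.X * Q, by simp, fun k => (h (k + 1)).congr fun N => ?_⟩
  simp only [Pi.mul_apply, Polynomial.eval_mul, Polynomial.eval_X]; ring

lemma smul_mem_logAsymp {i w : ℕ} {v : ℂ} {f : ℕ → ℂ} (hv : v ∈ limitSpan i)
    (hf : f ∈ logAsymp w) : v • f ∈ logAsymp (i + w) := by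
  obtain ⟨Q, hQ, h⟩ := hf
  refine ⟨Polynomial.C v * Q, by simpa using mul_mem_limitSpan hv hQ, fun k => ?_⟩
  have := (h k).const_mul v
  rw [mul_zero] at this
  refine this.congr fun N => ?_
  simp only [Pi.smul_apply, smul_eq_mul, Polynomial.eval_mul, Polynomial.eval_C]; ring

lemma coloredSum_mem_logAsymp {c : List (ℕ × ℂ)} (hc : IsWord c) (hc' : c.head? ≠ some (1, 1)) :
    coloredSum c ∈ logAsymp (wordWeight c) := by
  obtain ⟨v, C, hv⟩ := exists_norm_coloredSum_sub_le hc hc'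
  refine ⟨Polynomial.C v, ?_, fun k => ?_⟩
  · rw [Polynomial.coeff_C_zero]
    exact Submodule.subset_span ⟨c, hc, hc', rfl, tendsto_of_norm_sub_le hv⟩
  obtain ⟨D, hD0, hD⟩ := exists_harmonic_pow_le k (ε := 1 / 4) (by norm_num)
  rw [tendsto_zero_iff_norm_tendsto_zero]
  have hlim := (tendsto_rpow_neg_natCast_add_one (ε := 1 / 4) (by norm_num)).const_mul (D * C)
  rw [mul_zero] at hlim
  refine squeeze_zero (fun n => norm_nonneg _) (fun n => ?_) hlim
  have hn : (0 : ℝ) < (n : ℝ) + 1 := by positivity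
  have hH : ‖(harmonic n : ℂ)‖ = (harmonic n : ℝ) := by
    rw [← Complex.ofReal_ratCast, Complex.norm_of_nonneg (harmonic_real_nonneg n)]
  rw [norm_mul, norm_pow, hH, Polynomial.eval_C]
  refine (mul_le_mul (hD n) (hv n) (norm_nonneg _) (by positivity)).trans (le_of_eq ?_)
  rw [show (-(1 / 4) : ℝ) = 1 / 4 + -(1 / 2) by norm_num, Real.rpow_add hn]; ring

lemma harmonic_eq_nestSum : (fun N => (harmonic N : ℂ)) = nestSum 1 1 1 := by
  ext N
  rw [harmonic_eq_sum_Icc]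
  simp [nestSum]

/-- Modulo words with at most `k` leading letters `(1, 1)`, multiplication by `H_N` adds such a
letter to a word that has `k` of them, with multiplicity `k + 1`. -/
lemma harmonic_mul_sub_mem_leadSpan {c : List (ℕ × ℂ)} (hc : IsWord c)
    (hc' : c.head? ≠ some (1, 1)) (k : ℕ) :
    (fun N => (harmonic N : ℂ)) * coloredSum (List.replicate k (1, 1) ++ c) -
      ((k : ℚ) + 1) • coloredSum (List.replicate (k + 1) (1, 1) ++ c) ∈
      leadSpan k (k + 1 + wordWeight c) := by
  induction k with
  | zero =>
    rcases c with _ | ⟨d, ds⟩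
    · have : (fun N => (harmonic N : ℂ)) * coloredSum (List.replicate 0 (1, 1) ++ []) -
          (((0 : ℕ) : ℚ) + 1) • coloredSum (List.replicate (0 + 1) (1, 1) ++ []) = 0 := by
        rw [harmonic_eq_nestSum]
        simp [coloredSum_cons, coloredSum_nil]
      rw [this]
      exact zero_mem _
    · have hd' : (d.1, d.2) ≠ (1, 1) := by simpa using hc'
      obtain ⟨⟨hd1, hd2⟩, hds⟩ := isWord_cons.1 hc
      have hH : IsWord [(1, 1)] := by simp [IsWord]
      have e : (fun N => (harmonic N : ℂ)) * coloredSum (List.replicate 0 (1, 1) ++ d :: ds) -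
          (((0 : ℕ) : ℚ) + 1) • coloredSum (List.replicate (0 + 1) (1, 1) ++ d :: ds) =
          nestSum d.1 d.2 (coloredSum [(1, 1)] * coloredSum ds) +
            nestSum (1 + d.1) (1 * d.2) (coloredSum ds) := by
        rw [harmonic_eq_nestSum]
        have h : coloredSum (List.replicate (0 + 1) (1, 1) ++ d :: ds) =
          nestSum 1 1 (coloredSum (d :: ds)) := rfl
        rw [h, coloredSum_cons d, coloredSum_cons _ [], coloredSum_nil, List.replicate_zero,
          List.nil_append, coloredSum_cons d, nestSum_mul_nestSum]
        simp
        abel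
      rw [e]
      refine add_mem (nestSum_mem_leadSpan_zero hd1 hd2 hd' ?_ (coloredSum_mul_mem_wordSpan hH hds))
        (nestSum_mem_leadSpan_zero (by omega) (by simpa using hd2) ?_ ?_
          (coloredSum_mem_wordSpan hds))
      · simp [wordWeight]; omega
      · intro h
        have := congrArg Prod.fst h
        simp only at this
        omega
      · rw [wordWeight_cons]; omega
  | succ k ih =>
    set f := coloredSum (List.replicate k (1, 1) ++ c) with hf
    set g := coloredSum (List.replicate (k + 1) (1, 1) ++ c) with hg
    have hgf : g = nestSum 1 1 f := rfl
    have hword : IsWord (List.replicate k ((1 : ℕ), (1 : ℂ)) ++ c) := by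
      intro a ha
      rcases List.mem_append.1 ha with h | h
      · rw [List.eq_of_mem_replicate h]; simp
      · exact hc a h
    have e : (fun N => (harmonic N : ℂ)) * g - (((k + 1 : ℕ) : ℚ) + 1) •
        coloredSum (List.replicate (k + 1 + 1) (1, 1) ++ c) =
        nestSum 1 1 ((fun N => (harmonic N : ℂ)) * f - ((k : ℚ) + 1) • g) +
          nestSum (1 + 1) 1 f := by
      have h2 : coloredSum (List.replicate (k + 1 + 1) (1, 1) ++ c) = nestSum 1 1 g := rfl
      have h3 : (fun N => (harmonic N : ℂ)) * g = nestSum 1 1 g +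
          nestSum 1 1 ((fun N => (harmonic N : ℂ)) * f) + nestSum (1 + 1) 1 f := by
        conv_lhs => rw [harmonic_eq_nestSum, hgf, nestSum_mul_nestSum]
        rw [← harmonic_eq_nestSum, ← hgf]
        simp
      rw [h2, h3, map_sub, map_smul, Nat.cast_add_one, add_smul (_ + _) (1 : ℚ), one_smul]
      abel
    rw [e]
    refine add_mem ?_ (leadSpan_mono (Nat.zero_le _)
      (nestSum_mem_leadSpan_zero (by norm_num) (by norm_num) (by simp) ?_
        (coloredSum_mem_wordSpan hword)))
    · have := nestSum_one_mem_leadSpan ih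
      rwa [show k + 1 + wordWeight c + 1 = k + 1 + 1 + wordWeight c by ring] at this
    · simp [wordWeight]; omega

lemma leadSpan_le_logAsymp (k w : ℕ) : leadSpan k w ≤ logAsymp w := by
  induction k generalizing w with
  | zero =>
    refine Submodule.span_le.2 ?_
    rintro _ ⟨j, c, hj, hc, hh, rfl, rfl⟩
    obtain rfl : j = 0 := by omega
    simpa using coloredSum_mem_logAsymp hc hh
  | succ k ih =>
    refine Submodule.span_le.2 ?_
    rintro _ ⟨j, c, hj, hc, hh, rfl, rfl⟩
    rcases Nat.lt_or_ge k j with h | h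
    · obtain rfl : j = k + 1 := by omega
      have h1 := ih _ (harmonic_mul_sub_mem_leadSpan hc hh k)
      have h2 : coloredSum (List.replicate k (1, 1) ++ c) ∈ logAsymp (k + wordWeight c) :=
        ih _ (Submodule.subset_span ⟨k, c, le_rfl, hc, hh, rfl, rfl⟩)
      have h3 := sub_mem (harmonic_mul_mem_logAsymp (v := k + 1 + wordWeight c) h2) h1
      rw [sub_sub_cancel] at h3
      have hk : ((k : ℚ) + 1) ≠ 0 := by positivity
      exact ((logAsymp _).smul_mem_iff hk).1 h3
    · exact ih _ (Submodule.subset_span ⟨j, c, h, hc, hh, rfl, rfl⟩)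

lemma exists_eq_replicate_append (c : List (ℕ × ℂ)) :
    ∃ j d, d.head? ≠ some (1, 1) ∧ c = List.replicate j (1, 1) ++ d := by
  induction c with
  | nil => exact ⟨0, [], by simp, rfl⟩
  | cons a c ih =>
    by_cases h : a = (1, 1)
    · obtain ⟨j, d, hd, rfl⟩ := ih
      exact ⟨j + 1, d, hd, by rw [h]; rfl⟩
    · exact ⟨0, a :: c, by simpa using h, rfl⟩

lemma coloredSum_mem_logAsymp_of_isWord {c : List (ℕ × ℂ)} (hc : IsWord c) :
    coloredSum c ∈ logAsymp (wordWeight c) := by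
  obtain ⟨j, d, hd, rfl⟩ := exists_eq_replicate_append c
  refine leadSpan_le_logAsymp j _ (Submodule.subset_span ⟨j, d, le_rfl, ?_, hd, ?_, rfl⟩)
  · exact fun a ha => hc a (List.mem_append_right _ ha)
  · simp [wordWeight]

lemma tendsto_norm_harmonic : Tendsto (fun N => ‖(harmonic N : ℂ)‖) atTop atTop := by
  have h : ∀ N : ℕ, Real.log (N + 1) ≤ ‖(harmonic N : ℂ)‖ := fun N => by
    rw [← Complex.ofReal_ratCast, Complex.norm_of_nonneg (harmonic_real_nonneg N)]
    exact_mod_cast log_add_one_le_harmonic N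
  refine tendsto_atTop_mono h (Real.tendsto_log_atTop.comp ?_)
  exact tendsto_atTop_add_const_right _ _ tendsto_natCast_atTop_atTop

/-- A polynomial in `H_N` that converges is constant. -/
lemma mem_limitSpan_of_tendsto {w : ℕ} {f : ℕ → ℂ} (hf : f ∈ logAsymp w) {v : ℂ}
    (hv : Tendsto (fun M => f (2 * M)) atTop (𝓝 v)) : v ∈ limitSpan w := by
  obtain ⟨Q, hQ, h⟩ := hf
  have h2 : Tendsto (fun M : ℕ => 2 * M) atTop atTop :=
    tendsto_id.const_mul_atTop' two_pos
  have h0 := (h 0).comp h2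
  have hlim : Tendsto (fun M : ℕ => Q.eval (harmonic (2 * M) : ℂ)) atTop (𝓝 v) := by
    have := hv.sub h0
    rw [sub_zero] at this
    refine this.congr fun M => ?_
    simp
  have hdeg : ¬ 0 < Q.degree := fun hd =>
    not_tendsto_nhds_of_tendsto_atTop
      (Q.tendsto_norm_atTop hd (tendsto_norm_harmonic.comp h2)) _ hlim.norm
  rw [Polynomial.eq_C_of_degree_le_zero (not_lt.1 hdeg)] at hlim
  simp only [Polynomial.eval_C] at hlim
  rwa [tendsto_nhds_unique hlim tendsto_const_nhds]

/-! ### Truncated sums with coefficients -/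

/-- The span of the products of a number in `limitSpan i` with a truncated colored sum of weight
`w - i`. -/
noncomputable def mixedSpan (w : ℕ) : Submodule ℚ (ℕ → ℂ) :=
  Submodule.span ℚ {f | ∃ (i : ℕ) (v : ℂ) (c : List (ℕ × ℂ)), v ∈ limitSpan i ∧ IsWord c ∧
    i + wordWeight c = w ∧ f = v • coloredSum c}

lemma mixedSpan_le_logAsymp (w : ℕ) : mixedSpan w ≤ logAsymp w := by
  refine Submodule.span_le.2 ?_
  rintro _ ⟨i, v, c, hv, hc, rfl, rfl⟩
  exact smul_mem_logAsymp hv (coloredSum_mem_logAsymp_of_isWord hc)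

lemma const_mem_mixedSpan {w : ℕ} {v : ℂ} (hv : v ∈ limitSpan w) :
    (fun _ => v) ∈ mixedSpan w := by
  refine Submodule.subset_span ⟨w, v, [], hv, isWord_nil, rfl, ?_⟩
  ext N; simp [coloredSum]

/-- The variant of `nestSum` with a non-strict inequality between the summation indices. -/
noncomputable def starNestSum (k : ℕ) (z : ℂ) : (ℕ → ℂ) →ₗ[ℚ] (ℕ → ℂ) where
  toFun f N := ∑ n ∈ Finset.Icc 1 N, z ^ n / (n : ℂ) ^ k * f n
  map_add' f g := by ext N; simp [mul_add, Finset.sum_add_distrib]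
  map_smul' q f := by ext N; simp [Finset.smul_sum]

lemma starNestSum_smul (k : ℕ) (z v : ℂ) (f : ℕ → ℂ) :
    starNestSum k z (v • f) = v • starNestSum k z f := by
  ext N
  simp only [starNestSum, LinearMap.coe_mk, AddHom.coe_mk, Pi.smul_apply, smul_eq_mul,
    Finset.mul_sum]
  exact Finset.sum_congr rfl fun n _ => by ring

lemma starNestSum_nestSum (k l : ℕ) (y z : ℂ) (f : ℕ → ℂ) :
    starNestSum k y (nestSum l z f) = nestSum k y (nestSum l z f) + nestSum (k + l) (y * z) f := by
  ext N
  induction N with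
  | zero => simp [nestSum_at_zero, starNestSum]
  | succ N ih =>
    have h : ∀ g : ℕ → ℂ, starNestSum k y g (N + 1) = starNestSum k y g N +
        y ^ (N + 1) / ((N : ℂ) + 1) ^ k * g (N + 1) := by
      intro g; simp [starNestSum, Finset.sum_Icc_succ_top]
    rw [h, ih]
    simp only [Pi.add_apply, nestSum_at_succ]
    rw [pow_add _ k l, mul_pow, mul_div_mul_comm]
    ring

lemma starNestSum_one (k : ℕ) (z : ℂ) : starNestSum k z 1 = nestSum k z 1 := by
  ext N; simp [starNestSum, nestSum]

lemma starNestSum_mem_mixedSpan {k w v : ℕ} {z : ℂ} {f : ℕ → ℂ} (hk : 1 ≤ k) (hz : z ^ 2 = 1)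
    (hv : w + k = v) (hf : f ∈ mixedSpan w) : starNestSum k z f ∈ mixedSpan v := by
  suffices h : mixedSpan w ≤ (mixedSpan v).comap (starNestSum k z) from h hf
  refine Submodule.span_le.2 ?_
  rintro _ ⟨i, u, c, hu, hc, rfl, rfl⟩
  rw [SetLike.mem_coe, Submodule.mem_comap, starNestSum_smul]
  have hw : ∀ {d : List (ℕ × ℂ)}, IsWord d → i + wordWeight d = v →
      u • coloredSum d ∈ mixedSpan v :=
    fun {d} h1 h2 => Submodule.subset_span ⟨i, u, d, hu, h1, h2, rfl⟩
  have hkc : u • coloredSum ((k, z) :: c) ∈ mixedSpan v :=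
    hw (isWord_cons.2 ⟨⟨hk, hz⟩, hc⟩) (by rw [wordWeight_cons, ← hv]; ring)
  rcases c with _ | ⟨d, ds⟩
  · rw [coloredSum_nil, starNestSum_one]
    exact hkc
  · obtain ⟨⟨hd1, hd2⟩, hds⟩ := isWord_cons.1 hc
    rw [coloredSum_cons, starNestSum_nestSum, smul_add]
    refine add_mem hkc (hw (d := (k + d.1, z * d.2) :: ds) (isWord_cons.2 ⟨⟨?_, ?_⟩, hds⟩) ?_)
    · simp only; omega
    · simp only [mul_pow, hz, hd2, one_mul]
    · simp only [wordWeight_cons] at hv ⊢; omega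

/-! ### Sums over odd and over even integers -/

/-- The sum of `d i / n ^ q` over the integers `n = 2 * i + 1 + s ≤ N` with `i ≥ 0`: the odd ones
for `s = 0`, the even ones for `s = 1`. -/
noncomputable def latticeSum (s q : ℕ) (d : ℕ → ℝ) (N : ℕ) : ℂ :=
  ∑ n ∈ Finset.Icc 1 N, if Odd (n + s) then (d ((n - 1) / 2) : ℂ) / (n : ℂ) ^ q else 0

/-- The restriction to one parity class is a combination of the letters `1` and `-1`. -/
lemma latticeSum_mem_mixedSpan {s q w : ℕ} (hs : s < 2) (hq : 1 ≤ q) {f : ℕ → ℂ} {e : ℕ → ℝ}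
    (hf : f ∈ mixedSpan w) (he : ∀ i, f (2 * i + 1 + s) = e i) :
    latticeSum s q e ∈ mixedSpan (w + q) := by
  have h : latticeSum s q e =
      (1 / 2 : ℚ) • (starNestSum q 1 f - ((-1 : ℚ) ^ s) • starNestSum q (-1) f) := by
    ext N
    simp only [latticeSum, starNestSum, LinearMap.coe_mk, AddHom.coe_mk, Pi.smul_apply,
      Pi.sub_apply, Finset.smul_sum, ← Finset.sum_sub_distrib]
    refine Finset.sum_congr rfl fun n hn => ?_
    obtain ⟨hn, -⟩ := Finset.mem_Icc.1 hn
    simp only [Rat.smul_def]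
    push_cast
    have hsplit : (-1 : ℂ) ^ s * ((-1) ^ n / (n : ℂ) ^ q * f n) =
      (-1) ^ (n + s) * (f n / (n : ℂ) ^ q) := by rw [pow_add]; ring
    rw [hsplit]
    split_ifs with h
    · have hne : n = 2 * ((n - 1) / 2) + 1 + s := by
        obtain ⟨t, ht⟩ := h; omega
      rw [h.neg_one_pow, ← he, ← hne]; ring
    · rw [(Nat.not_odd_iff_even.1 h).neg_one_pow]; ring
  rw [h]
  exact Submodule.smul_mem _ _ (sub_mem (starNestSum_mem_mixedSpan hq (by norm_num) rfl hf)
    (Submodule.smul_mem _ _ (starNestSum_mem_mixedSpan hq (by norm_num) rfl hf)))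

lemma latticeSum_recursion {s : ℕ} (hs : s < 2) {d e d' : ℕ → ℝ}
    (h : ∀ i : ℕ, (2 * i + 1 + s : ℝ) * d i = 2 * e i + d' i) (q : ℕ) :
    latticeSum s q d = (2 : ℚ) • latticeSum s (q + 1) e + latticeSum s (q + 1) d' := by
  ext N
  simp only [latticeSum, Pi.add_apply, Pi.smul_apply, Finset.smul_sum, ← Finset.sum_add_distrib]
  refine Finset.sum_congr rfl fun n hn => ?_
  obtain ⟨hn, -⟩ := Finset.mem_Icc.1 hn
  split_ifs with ho
  · have hne : n = 2 * ((n - 1) / 2) + 1 + s := by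
      obtain ⟨t, ht⟩ := ho; omega
    have hn0 : (n : ℂ) ≠ 0 := by exact_mod_cast (by omega : n ≠ 0)
    have h1 := h ((n - 1) / 2)
    have h2 : (n : ℝ) = 2 * ((n - 1) / 2 : ℕ) + 1 + s := by exact_mod_cast hne
    rw [← h2] at h1
    have h3 : (n : ℂ) * d ((n - 1) / 2) = 2 * e ((n - 1) / 2) + d' ((n - 1) / 2) := by
      exact_mod_cast h1
    rw [Rat.smul_def, Rat.cast_ofNat, ← mul_div_assoc, ← add_div, ← h3, pow_succ]
    field_simp
  · simp

lemma latticeSum_zero_eq {s : ℕ} (hs : s < 2) {v d : ℕ → ℝ} (h : ∀ i, v (i + 1) = v i + d i)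
    (N : ℕ) : latticeSum s 0 d N = v ((N + 1 - s) / 2) - v 0 := by
  induction N with
  | zero =>
    have : (0 + 1 - s) / 2 = 0 := by omega
    simp [latticeSum, this]
  | succ N ih =>
    have hstep : latticeSum s 0 d (N + 1) = latticeSum s 0 d N +
        if Odd (N + 1 + s) then (d (N / 2) : ℂ) else 0 := by
      simp [latticeSum, Finset.sum_Icc_succ_top]
    rw [hstep, ih]
    split_ifs with ho
    · obtain ⟨t, ht⟩ := ho
      have e1 : (N + 1 + 1 - s) / 2 = N / 2 + 1 := by omega
      have e2 : (N + 1 - s) / 2 = N / 2 := by omega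
      rw [e1, e2, h]; push_cast; ring
    · obtain ⟨t, ht⟩ := Nat.not_odd_iff_even.1 ho
      have e1 : (N + 1 + 1 - s) / 2 = (N + 1 - s) / 2 := by omega
      rw [e1, add_zero]

/-! ### Newton series at integers -/

/-- The values at integers are `-backDiff^[N] (starTerm m k) 0`, with increments
`backDiff^[N] (starTerm m k) 1`; they satisfy the recursions with `N + 1` in place of
`N + 1 - α`. -/
lemma latticeSum_one_backDiff_mem {m : ℕ} (hm : 1 ≤ m) {k : List ℕ} (hk : ∀ a ∈ k, 1 ≤ a) (q : ℕ) :
    latticeSum 1 q (fun N => backDiff^[N] (starTerm m k) 1) ∈ mixedSpan (m + k.sum + q) := by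
  have base : ∀ {f g : ℕ → ℝ} {w : ℕ},
      (∀ i : ℕ, g (i + 1) = ((i + 1 : ℕ) : ℝ) * f (i + 1) - i * f i) →
      (∀ q, 1 ≤ q → latticeSum 1 q (fun N => backDiff^[N] g 1) ∈ mixedSpan (w + q)) → ∀ q,
      latticeSum 1 q (fun N => backDiff^[N] f 1) ∈ mixedSpan (1 + w + q) := by
    intro f g w hfg hg q
    rw [latticeSum_recursion (e := fun N => backDiff^[N] g 1) (d' := fun _ => 0) (by norm_num)
      fun N => ?_]
    · have h0 : latticeSum 1 (q + 1) (fun _ => 0) = 0 := by ext N; simp [latticeSum]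
      rw [h0, add_zero, show 1 + w + q = w + (q + 1) by ring]
      exact Submodule.smul_mem _ _ (hg _ (by omega))
    · have := backDiff_iterate_of_sum hfg N 0
      simp only [zero_add] at this
      rw [this]; push_cast; ring
  have step : ∀ {m : ℕ} {k : List ℕ}, 1 ≤ m →
      (∀ q, latticeSum 1 q (fun N => backDiff^[N] (starTerm m k) 1) ∈ mixedSpan (m + k.sum + q)) →
      ∀ q, latticeSum 1 q (fun N => backDiff^[N] (starTerm (m + 1) k) 1) ∈
        mixedSpan (m + 1 + k.sum + q) := by
    intro m k hm ih q
    have hfg : starTerm m k = fun i : ℕ => (i : ℝ) * starTerm (m + 1) k i :=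
      funext (starTerm_eq_id_mul m hm k)
    set T : ℕ → ℝ := fun N => -backDiff^[N] (starTerm m k) 0 with hT
    have hTs : ∀ N, T (N + 1) = T N + backDiff^[N] (starTerm m k) 1 := by
      intro N; simp only [hT]; rw [backDiff_iterate_succ]; ring
    rw [latticeSum_recursion (e := fun N => T (N + 1)) (d' := fun _ => 0) (by norm_num)
      fun N => ?_]
    · have h0 : latticeSum 1 (q + 1) (fun _ => 0) = 0 := by ext N; simp [latticeSum]
      rw [h0, add_zero, show m + 1 + k.sum + q = m + k.sum + 0 + (q + 1) by ring]
      refine Submodule.smul_mem _ _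
        (latticeSum_mem_mixedSpan (by norm_num) (by omega) (ih 0) fun i => ?_)
      rw [latticeSum_zero_eq (by norm_num) hTs, show (2 * i + 1 + 1 + 1 - 1) / 2 = i + 1 by omega]
      simp [hT, starTerm_zero hm]
    · have h := backDiff_iterate_id_mul (starTerm (m + 1) k) N 0
      rw [← hfg] at h
      simp only [hT]
      rw [h]; push_cast; ring
  induction k generalizing m q with
  | nil =>
    induction m, hm using Nat.le_induction generalizing q with
    | base =>
      refine base (w := 0) unitTerm_eq (fun q hq => ?_) q
      have h1 : (fun N => backDiff^[N] unitTerm 1) = fun _ => 1 := by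
        ext N; simpa using backDiff_iterate_unitTerm N 0
      rw [h1]
      exact latticeSum_mem_mixedSpan (by norm_num) hq (const_mem_mixedSpan one_mem_limitSpan)
        (by simp)
    | succ m hm ih => exact step hm ih q
  | cons k₁ k ihk =>
    induction m, hm using Nat.le_induction generalizing q with
    | base =>
      rw [List.sum_cons]
      exact base (starTerm_one_cons k₁ k) (fun q _ => ihk (hk k₁ (by simp))
        (fun a ha => hk a (by simp [ha])) q) q
    | succ m hm ih => exact step hm ih q

/-! ### Newton series at half-integers -/

/-- Induction on the power of `x` for the equation `(N + 1 - α) * d = e` between power series in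
`x`, where `α = (1 + x) / 2`. -/
lemma latticeSum_mem_of_recursion {w : ℕ} {d e : ℕ → ℕ → ℝ}
    (h0 : ∀ N : ℕ, (2 * N + 1 : ℝ) * d 0 N = 2 * e 0 N)
    (hs : ∀ p N : ℕ, (2 * N + 1 : ℝ) * d (p + 1) N = 2 * e (p + 1) N + d p N)
    (he : ∀ p q, 1 ≤ q → latticeSum 0 q (e p) ∈ mixedSpan (w + p + q)) (p q : ℕ) :
    latticeSum 0 q (d p) ∈ mixedSpan (w + 1 + p + q) := by
  induction p generalizing q with
  | zero =>
    rw [latticeSum_recursion (e := e 0) (d' := fun _ => 0) (by norm_num) fun N => ?_]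
    · have h0 : latticeSum 0 (q + 1) (fun _ => 0) = 0 := by ext N; simp [latticeSum]
      rw [h0, add_zero (_ • _), show w + 1 + 0 + q = w + 0 + (q + 1) by ring]
      exact Submodule.smul_mem _ _ (he 0 (q + 1) (by omega))
    · have := h0 N
      push_cast; linarith
  | succ p ih =>
    rw [latticeSum_recursion (e := e (p + 1)) (d' := d p) (by norm_num) fun N => ?_]
    · refine add_mem (Submodule.smul_mem _ _ ?_) ?_
      · rw [show w + 1 + (p + 1) + q = w + (p + 1) + (q + 1) by ring]
        exact he (p + 1) (q + 1) (by omega)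
      · rw [show w + 1 + (p + 1) + q = w + 1 + p + (q + 1) by ring]
        exact ih _
    · have := hs p N
      push_cast; linarith

/-- The regularization step: the value of the Newton series at `-1 / 2` is the limit of a
combination of truncated sums, because the Newton series at `M - 1 / 2` and `M` are asymptotic. -/
lemma newtonValue_zero_mem {m : ℕ} (hm : 1 ≤ m) {k : List ℕ} (hk : ∀ a ∈ k, 1 ≤ a) {p : ℕ}
    (h : latticeSum 0 0 (newtonDiff (aperyWeight p) (starTerm m k)) ∈ mixedSpan (m + k.sum + p)) :
    (newtonValue (aperyWeight p) (starTerm m k) 0 : ℂ) ∈ limitSpan (m + k.sum + p) := by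
  have ha := isWeight_aperyWeight p
  have hf := isTame_starTerm hm hk
  set V := newtonValue (aperyWeight p) (starTerm m k)
  set T : ℕ → ℝ := fun N => -backDiff^[N] (starTerm m k) 0 with hT
  have hTs : ∀ N, T (N + 1) = T N + backDiff^[N] (starTerm m k) 1 := by
    intro N; simp only [hT]; rw [backDiff_iterate_succ]; ring
  set L := latticeSum 1 0 (fun N => backDiff^[N] (starTerm m k) 1)
  have hL : ((if p = 0 then 1 else 0 : ℚ) • L) ∈ mixedSpan (m + k.sum + p) := by
    split_ifs with hp
    · rw [one_smul, hp]
      exact latticeSum_one_backDiff_mem hm hk 0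
    · rw [zero_smul]; exact zero_mem _
  refine mem_limitSpan_of_tendsto (mixedSpan_le_logAsymp _ (sub_mem hL h)) ?_
  have hlim := (tendsto_newtonValue_add ha hf).const_sub (V 0)
  rw [sub_zero] at hlim
  have hlim' := (Complex.continuous_ofReal.tendsto _).comp hlim
  refine hlim'.congr fun M => ?_
  have e1 : L (2 * M) = (T M : ℂ) := by
    change latticeSum 1 0 (fun N => backDiff^[N] (starTerm m k) 1) (2 * M) = _
    rw [latticeSum_zero_eq (by norm_num) hTs, show (2 * M + 1 - 1) / 2 = M by omega]
    simp [hT, starTerm_zero hm]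
  simp only [Function.comp_apply, Pi.sub_apply, Pi.smul_apply]
  rw [latticeSum_zero_eq (by norm_num) (newtonValue_succ ha hf),
    show (2 * M + 1 - 0) / 2 = M by omega, e1, aperyWeight_at_zero]
  simp only [hT]
  split_ifs <;> push_cast [Rat.smul_def] <;> ring

lemma newtonValue_mem_mixedSpan {m : ℕ} (hm : 1 ≤ m) {k : List ℕ} (hk : ∀ a ∈ k, 1 ≤ a) {p : ℕ}
    (h : latticeSum 0 0 (newtonDiff (aperyWeight p) (starTerm m k)) ∈ mixedSpan (m + k.sum + p)) :
    (fun N => (newtonValue (aperyWeight p) (starTerm m k) ((N + 1) / 2) : ℂ)) ∈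
      mixedSpan (m + k.sum + p) := by
  have := add_mem (const_mem_mixedSpan (newtonValue_zero_mem hm hk h)) h
  convert this using 1
  ext N
  rw [Pi.add_apply, latticeSum_zero_eq (by norm_num)
    (newtonValue_succ (isWeight_aperyWeight p) (isTame_starTerm hm hk)), Nat.sub_zero]
  ring

lemma latticeSum_newtonDiff_mem {m : ℕ} (hm : 1 ≤ m) {k : List ℕ} (hk : ∀ a ∈ k, 1 ≤ a) (p q : ℕ) :
    latticeSum 0 q (newtonDiff (aperyWeight p) (starTerm m k)) ∈ mixedSpan (m + k.sum + p + q) := by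
  have zero_diff : ∀ (f : ℕ → ℝ) (N : ℕ), newtonDiff (fun _ => 0) f N = 0 := fun f N => by
    simp [newtonDiff]
  have base : ∀ {f g : ℕ → ℝ} {w : ℕ}, IsTame f →
      (∀ p N, Summable fun j => aperyWeight p j * backDiff^[N] g (j + 1)) →
      (∀ i : ℕ, g (i + 1) = ((i + 1 : ℕ) : ℝ) * f (i + 1) - i * f i) →
      (∀ p q, 1 ≤ q → latticeSum 0 q (newtonDiff (aperyWeight p) g) ∈ mixedSpan (w + p + q)) →
      ∀ p q, latticeSum 0 q (newtonDiff (aperyWeight p) f) ∈ mixedSpan (w + 1 + p + q) := by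
    intro f g w hf hg hfg he
    refine latticeSum_mem_of_recursion (e := fun p => newtonDiff (aperyWeight p) g)
      (fun N => ?_) (fun p N => ?_) he
    · rw [newtonDiff_recursion_sum (isWeight_aperyWeight 0) isWeight_zero aperyWeight_zero_succ hf
        (hg 0) hfg, zero_diff, add_zero]
    · exact newtonDiff_recursion_sum (isWeight_aperyWeight _) (isWeight_aperyWeight p)
        (aperyWeight_succ_succ p) hf (hg _) hfg N
  have step : ∀ {m : ℕ} {k : List ℕ}, 1 ≤ m → (∀ a ∈ k, 1 ≤ a) →
      (∀ p q, latticeSum 0 q (newtonDiff (aperyWeight p) (starTerm m k)) ∈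
        mixedSpan (m + k.sum + p + q)) →
      ∀ p q, latticeSum 0 q (newtonDiff (aperyWeight p) (starTerm (m + 1) k)) ∈
        mixedSpan (m + 1 + k.sum + p + q) := by
    intro m k hm hk ih p q
    have hfg := starTerm_eq_id_mul m hm k
    have hf := isTame_starTerm (m := m + 1) (by omega) hk
    have hg := isTame_starTerm hm hk
    rw [show m + 1 + k.sum + p + q = m + k.sum + 1 + p + q by ring]
    refine latticeSum_mem_of_recursion
      (d := fun p => newtonDiff (aperyWeight p) (starTerm (m + 1) k))
      (e := fun p N => newtonValue (aperyWeight p) (starTerm m k) (N + 1))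
      (fun N => ?_) (fun p N => ?_) (fun p q hq => ?_) p q
    · rw [newtonDiff_recursion_id_mul (isWeight_aperyWeight 0) isWeight_zero aperyWeight_zero_succ
        hf hg hfg, zero_diff, add_zero]
    · exact newtonDiff_recursion_id_mul (isWeight_aperyWeight _) (isWeight_aperyWeight p)
        (aperyWeight_succ_succ p) hf hg hfg N
    · refine latticeSum_mem_mixedSpan (by norm_num) hq
        (newtonValue_mem_mixedSpan hm hk (ih p 0)) fun i => ?_
      rw [show (2 * i + 1 + 0 + 1) / 2 = i + 1 by omega]
  induction k generalizing m p q with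
  | nil =>
    induction m, hm using Nat.le_induction generalizing p q with
    | base =>
      have hsum : ∀ p N, HasSum (fun j => aperyWeight p j * backDiff^[N] unitTerm (j + 1))
          (aperyWeight p 0) := fun p N => by
        convert hasSum_ite_eq (0 : ℕ) (aperyWeight p 0) using 2 with j
        rw [backDiff_iterate_unitTerm]
        split_ifs with h <;> simp [h]
      refine base (w := 0) (isTame_starTerm le_rfl hk) (fun p N => (hsum p N).summable) unitTerm_eq
        (fun p q hq => ?_) p q
      have h1 : newtonDiff (aperyWeight p) unitTerm = fun _ => aperyWeight p 0 :=
        funext fun N => (hsum p N).tsum_eq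
      rw [h1]
      refine latticeSum_mem_mixedSpan (f := fun _ => (aperyWeight p 0 : ℂ)) (by norm_num) hq
        (const_mem_mixedSpan ?_) (by simp)
      rw [aperyWeight_at_zero]
      split_ifs with hp
      · rw [hp, Complex.ofReal_one]; exact one_mem_limitSpan
      · rw [Complex.ofReal_zero]; exact zero_mem _
    | succ m hm ih => exact step hm hk ih p q
  | cons k₁ k ihk =>
    have hk1 : 1 ≤ k₁ := hk k₁ (by simp)
    have hk' : ∀ a ∈ k, 1 ≤ a := fun a ha => hk a (by simp [ha])
    induction m, hm using Nat.le_induction generalizing p q with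
    | base =>
      rw [List.sum_cons, add_comm 1]
      exact base (isTame_starTerm le_rfl hk)
        (fun p N => summable_weight_mul_succ (isWeight_aperyWeight p) (isTame_starTerm hk1 hk') N)
        (starTerm_one_cons k₁ k) (fun p q _ => ihk hk1 hk' p q) p q
    | succ m hm ih => exact step hm hk ih p q

/-! ### The Apéry-type series -/

theorem mainTheorem10 (p m : ℕ) (hm : 1 ≤ m) (k : List ℕ) (hk : k ≠ [])
    (hkpos : ∀ a ∈ k, 1 ≤ a) :
    ∃ S : ℝ,
      HasSum (fun n : ℕ =>
        ((n + 1).centralBinom : ℝ) / 4 ^ (n + 1) *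
          (zetaStarSum k (n + 1) * tSum (List.replicate p 1) (n + 1)) /
            ((n + 1 : ℕ) : ℝ) ^ m) S ∧
      (S : ℂ) ∈ cmzvSpan 2 (k.sum + m + p) := by
  have ha := isWeight_aperyWeight p
  have hf := isTame_starTerm hm hkpos
  refine ⟨-newtonValue (aperyWeight p) (starTerm m k) 0, ?_, ?_⟩
  · have hs := summable_weight_mul ha hf 0
    have h0 : ∑ i ∈ Finset.range 1, aperyWeight p i * backDiff^[0] (starTerm m k) i = 0 := by
      simp [starTerm_zero hm]
    rw [newtonValue, neg_neg]
    have h := (hasSum_nat_add_iff' 1).2 hs.hasSum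
    rw [h0, sub_zero] at h
    refine (congrArg (HasSum · _) (funext fun n => ?_)).mp h
    rw [Function.iterate_zero, id, aperyWeight, starTerm]
    ring
  · have h := newtonValue_zero_mem hm hkpos
      (latticeSum_newtonDiff_mem hm hkpos p 0)
    rw [Complex.ofReal_neg, show k.sum + m + p = m + k.sum + p by ring]
    exact limitSpan_le_cmzvSpan (by omega) (neg_mem h)
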